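/- **Setting.** Let $\Omega\subseteq\mathbb R^2$ be open, with coordinates $(x,t)$; all functions are smooth functions $\Omega\to\mathbb C$ or matrices of such functions. Let $\mathcal A$ be an algebra of functions containing the constants, $\mathcal F\subseteq\mathcal A$ an ideal of it on which $\partial_x$ is a bijection $\mathcal F\to\mathcal F$, and $\mathcal E_+,\mathcal E_-$ two $\mathcal A$-modules of functions with $\mathcal E_-\mathcal E_+\subseteq\mathcal F$, all of them stable under $\partial_x$ and $\partial_t$. For $f\in\mathcal F$ let $D^{-1}\{f\}\in\mathcal F$ be the unique antiderivative of $f$ in $\mathcal F$ (typically $\mathcal F$ consists of functions decaying as $x\to-\infty$ and $D^{-1}\{f\}=\int_{-\infty}^x f$). Operators are multiplied in the algebra of formal matrix pseudodifferential operators in $D=\partial_x$, extended by $\partial_t$. $P\{f\}$ denotes the action on a function of $P=a\partial_t+\sum_i u_iD^i+\sum_\nu h_\nu D^{-1}g_\nu^\top$, that is $P\{f\}=af_t+\sum_i u_i\partial_x^if+\sum_\nu h_\nu D^{-1}\{g_\nu^\top f\}$, and $P^\tau=-a\partial_t+\sum_i(-1)^iD^iu_i^\top-\sum_\nu g_\nu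 D^{-1}h_\nu^\top$ is its formal transpose. Let $k,l,n\ge0$ be integers, $\alpha,c_l\in\mathbb C$, $\mathcal J,\tilde{\mathcal J}$ constant $N\times N$ matrices, $\mathcal M_0$ a constant $m\times m$ matrix, $u_i,v_i$ $N\times N$ matrices over $\mathcal A$, and ${\bf q},{\bf r}$ $N\times m$ matrices over $\mathcal E_+$ and $\mathcal E_-$ respectively. Put $$M_n=\alpha\partial_t-\tilde{\mathcal J}D^n-\sum_{i=0}^{n-1}v_iD^i-{\bf q}\mathcal M_0D^{-1}{\bf r}^\top,\qquad L_{k,l}=B_k+c_l\sum_{j=0}^l{\bf q}[j]\mathcal M_0D^{-1}{\bf r}^\top[l-j],$$ $$B_k=\mathcal JD^k+\sum_{i=0}^{k-1}u_iD^i,\qquad {\bf q}[j]=(M_n)^j\{{\bf q}\},\qquad {\bf r}[j]=(M_n^\tau)^j\{{\bf r}\},\qquad \tilde L_{k,l}=L_{k,l}+c_l(M_n)^{l+1}.$$ **Theorem.** Let $\Lambda,\tilde\Lambda,C$ be constant $K\times K$ matrices with $C$ nondegenerate, and let $\varphi,\psi$ be $N\times K$ matrices over $\mathcal E_+$ and $\mathcal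 E_-$ respectively, such that $$M_n\{\varphi\}=\varphi\Lambda,\quad M_n^\tau\{\psi\}=\psi\tilde\Lambda,\quad \tilde L_{k,l}\{\varphi\}=0,\quad \tilde L_{k,l}^\tau\{\psi\}=0,$$ and such that $\Delta=C+D^{-1}\{\psi^\top\varphi\}$ is invertible with $\Delta^{-1}$ a matrix over $\mathcal A$. Then $W=I-\varphi\Delta^{-1}D^{-1}\psi^\top$ is invertible with $W^{-1}=I+\varphi D^{-1}\Delta^{-1}\psi^\top$. Put $$\hat{\bf q}=W\{{\bf q}\},\ \ \hat{\bf r}=W^{-1,\tau}\{{\bf r}\},\ \ \Phi=\varphi\Delta^{-1},\ \ \Psi=\psi(\Delta^{-1})^\top,\ \ \mathcal M_1=C\Lambda-\tilde\Lambda^\top C.$$ There are $N\times N$ matrices $\hat v_i$ $(0\le i<n)$ and $\hat u_i$ $(0\le i<k)$ over $\mathcal A$, determined by $\varphi,\psi,C$ and the coefficients of $M_n$, respectively of $B_k$, namely $$\tilde{\mathcal J}D^n+\sum_{i<n}\hat v_iD^i=\Big(W\big(\tilde{\mathcal J}D^n+\sum_{i<n}v_iD^i\big)W^{-1}\Big)_{\ge0},\qquad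 \hat B_k:=\mathcal JD^k+\sum_{i<k}\hat u_iD^i=(WB_kW^{-1})_{\ge0},$$ such that $$\hat M_n:=WM_nW^{-1}=\alpha\partial_t-\tilde{\mathcal J}D^n-\sum_{i=0}^{n-1}\hat v_iD^i-\hat{\bf q}\mathcal M_0D^{-1}\hat{\bf r}^\top+\Phi\mathcal M_1D^{-1}\Psi^\top,$$ $$\hat L_{k,l}:=WL_{k,l}W^{-1}=\hat B_k+c_l\sum_{j=0}^l\hat{\bf q}[j]\mathcal M_0D^{-1}\hat{\bf r}^\top[l-j]-c_l\sum_{s=0}^l\Phi[s]\mathcal M_1D^{-1}\Psi^\top[l-s],$$ where $\hat{\bf q}[j]=(\hat M_n)^j\{\hat{\bf q}\}$, $\hat{\bf r}[j]=(\hat M_n^\tau)^j\{\hat{\bf r}\}$, $\Phi[s]=(\hat M_n)^s\{\Phi\}$, $\Psi[s]=(\hat M_n^\tau)^s\{\Psi\}$, and $$W\tilde L_{k,l}W^{-1}=\hat L_{k,l}+c_l(\hat M_n)^{l+1}.$$ -/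

import Mathlib

open scoped ContDiff

/-! ### Smooth functions of `(x, t)` on an open set -/

/-- Extension by zero of a function defined on `Ω`. -/
noncomputable def extendZero (Ω : TopologicalSpace.Opens (ℝ × ℝ)) (f : Ω → ℂ) : ℝ × ℝ → ℂ :=
  open Classical in fun p => if h : p ∈ Ω then f ⟨p, h⟩ else 0

theorem extendZero_coe (Ω : TopologicalSpace.Opens (ℝ × ℝ)) (f : Ω → ℂ) (p : Ω) :
    extendZero Ω f p = f p := by
  simp [extendZero]

theorem extendZero_add (Ω : TopologicalSpace.Opens (ℝ × ℝ)) (f g : Ω → ℂ) :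
    extendZero Ω (f + g) = fun p => extendZero Ω f p + extendZero Ω g p := by
  funext p; by_cases h : p ∈ Ω <;> simp [extendZero, h]

theorem extendZero_mul (Ω : TopologicalSpace.Opens (ℝ × ℝ)) (f g : Ω → ℂ) :
    extendZero Ω (f * g) = fun p => extendZero Ω f p * extendZero Ω g p := by
  funext p; by_cases h : p ∈ Ω <;> simp [extendZero, h]

theorem extendZero_smul (Ω : TopologicalSpace.Opens (ℝ × ℝ)) (c : ℂ) (f : Ω → ℂ) :
    extendZero Ω (c • f) = fun p => c • extendZero Ω f p := by
  funext p; by_cases h : p ∈ Ω <;> simp [extendZero, h]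

/-- The algebra of infinitely differentiable functions `Ω → ℂ`, `Ω ⊆ ℝ²` open. The first
coordinate is `x`, the second one is the time `t`. -/
noncomputable def SmoothFn (Ω : TopologicalSpace.Opens (ℝ × ℝ)) : Subalgebra ℂ (Ω → ℂ) where
  carrier := {f | ContDiffOn ℝ ∞ (extendZero Ω f) Ω}
  mul_mem' := fun {f g} hf hg => by
    have h : ContDiffOn ℝ ∞ (fun p => extendZero Ω f p * extendZero Ω g p) Ω := hf.mul hg
    simpa only [Set.mem_ofPred_eq, extendZero_mul] using h
  add_mem' := fun {f g} hf hg => by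
    have h : ContDiffOn ℝ ∞ (fun p => extendZero Ω f p + extendZero Ω g p) Ω := hf.add hg
    simpa only [Set.mem_ofPred_eq, extendZero_add] using h
  algebraMap_mem' := fun c => by
    have h : ContDiffOn ℝ ∞ (fun _ : ℝ × ℝ => c) (Ω : Set (ℝ × ℝ)) := contDiffOn_const
    refine h.congr fun p hp => ?_
    have := extendZero_coe Ω (algebraMap ℂ (Ω → ℂ) c) ⟨p, hp⟩
    simpa using this

theorem smoothFn_differentiableAt {Ω : TopologicalSpace.Opens (ℝ × ℝ)} (f : SmoothFn Ω) (p : Ω) :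
    DifferentiableAt ℝ (extendZero Ω f.1) p :=
  ((f.2 : ContDiffOn ℝ ∞ (extendZero Ω f.1) Ω).contDiffAt
    (Ω.isOpen.mem_nhds p.2)).differentiableAt (by simp)

/-- The directional derivative along the constant vector `w`, as a derivation of the algebra of
smooth functions. -/
noncomputable def dirDeriv (Ω : TopologicalSpace.Opens (ℝ × ℝ)) (w : ℝ × ℝ) :
    Derivation ℂ (SmoothFn Ω) (SmoothFn Ω) :=
  Derivation.mk'
    { toFun := fun f => ⟨fun p => fderiv ℝ (extendZero Ω f.1) p w, by
        have hf : ContDiffOn ℝ ∞ (extendZero Ω f.1) Ω := f.2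
        have h : ContDiffOn ℝ ∞ (fun p => fderiv ℝ (extendZero Ω f.1) p w) Ω :=
          (hf.fderiv_of_isOpen Ω.isOpen (by simp)).clm_apply contDiffOn_const
        exact h.congr fun p hp => extendZero_coe Ω _ ⟨p, hp⟩⟩
      map_add' := fun f g => by
        apply Subtype.ext; funext p
        have h := fderiv_fun_add (smoothFn_differentiableAt f p) (smoothFn_differentiableAt g p)
        simp [extendZero_add, h]
      map_smul' := fun c f => by
        apply Subtype.ext; funext p
        have h := fderiv_fun_const_smul (smoothFn_differentiableAt f p) c
        simpa [extendZero_smul] using congrArg (fun T => T w) h }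
    (fun f g => by
      apply Subtype.ext; funext p
      have h := fderiv_fun_mul (smoothFn_differentiableAt f p) (smoothFn_differentiableAt g p)
      simp [extendZero_mul, h, extendZero_coe])

/-- `∂/∂x`. -/
noncomputable def dx (Ω : TopologicalSpace.Opens (ℝ × ℝ)) :
    Derivation ℂ (SmoothFn Ω) (SmoothFn Ω) := dirDeriv Ω (1, 0)

/-- `∂/∂t`. -/
noncomputable def dt (Ω : TopologicalSpace.Opens (ℝ × ℝ)) :
    Derivation ℂ (SmoothFn Ω) (SmoothFn Ω) := dirDeriv Ω (0, 1)

/-! ### Function classes and the operator `D⁻¹{·}` on functions -/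

/-- A class of functions on which the calculus with `D⁻¹` makes sense.
* `coeff` is the algebra of admissible coefficients;
* `decay` is an ideal of `coeff` on which `∂/∂x` is bijective, so that `D⁻¹{·}` is defined on it
  (typically: functions that decay as `x → -∞`, with `D⁻¹{f} = ∫_{-∞}^x f`);
* `right` and `left` are the spaces from which the functions of type `q, φ` and of type `r, ψ`
  are taken: products of an element of `left` and an element of `right` are in `decay`.
Everything is stable under `∂/∂x` and `∂/∂t` and under multiplication by `coeff`. -/
structure FunctionClass (Ω : TopologicalSpace.Opens (ℝ × ℝ)) where
  coeff : Subalgebra ℂ (SmoothFn Ω)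
  decay : Submodule coeff (SmoothFn Ω)
  right : Submodule coeff (SmoothFn Ω)
  left : Submodule coeff (SmoothFn Ω)
  decay_le : ∀ f ∈ decay, f ∈ coeff
  mul_mem : ∀ g ∈ left, ∀ f ∈ right, g * f ∈ decay
  dx_coeff : ∀ f ∈ coeff, dx Ω f ∈ coeff
  dt_coeff : ∀ f ∈ coeff, dt Ω f ∈ coeff
  dx_right : ∀ f ∈ right, dx Ω f ∈ right
  dt_right : ∀ f ∈ right, dt Ω f ∈ right
  dx_left : ∀ f ∈ left, dx Ω f ∈ left
  dt_left : ∀ f ∈ left, dt Ω f ∈ left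
  dt_decay : ∀ f ∈ decay, dt Ω f ∈ decay
  dx_bijOn : Set.BijOn (dx Ω) decay decay

/-- `D⁻¹{f}`: the unique antiderivative of `f` in the class `decay` (for `f` in that class). -/
noncomputable def FunctionClass.dInv {Ω : TopologicalSpace.Opens (ℝ × ℝ)} (𝓒 : FunctionClass Ω)
    (f : SmoothFn Ω) : SmoothFn Ω :=
  Function.invFunOn (dx Ω) (𝓒.decay : Set (SmoothFn Ω)) f

/-! ### Formal pseudodifferential operators

Formal pseudodifferential operators in `D = ∂/∂x`, together with `∂/∂t`, are realised as operators
on formal series `∑ f_i z^i` (finitely many negative powers), which stand for the formal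
functions `(∑ f_i λ^{-i}) e^{λ x}`. On them `D` acts as `∂/∂x + λ`, which is invertible,
`D⁻¹ = ∑_k (-1)^k λ^{-k-1} ∂_x^k`; functions act by multiplication and `∂/∂t` acts on the
coefficients. The operator `∑_i a_i D^i` is determined by its value `∑_i a_i λ^i` at `1`. -/

/-- Formal series in `z = λ⁻¹` with smooth coefficients. -/
abbrev SymbolSeries (Ω : TopologicalSpace.Opens (ℝ × ℝ)) : Type := LaurentSeries (SmoothFn Ω)

/-- The algebra in which the (integro-)differential operators are composed. -/
abbrev PsiOp (Ω : TopologicalSpace.Opens (ℝ × ℝ)) : Type := Module.End ℂ (SymbolSeries Ω)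

/-- Coefficientwise application of a derivation. -/
noncomputable def coeffDeriv {Ω : TopologicalSpace.Opens (ℝ × ℝ)}
    (d : Derivation ℂ (SmoothFn Ω) (SmoothFn Ω)) : PsiOp Ω where
  toFun := fun s => HahnSeries.map s d
  map_add' := fun s s' => by ext1; funext i; simp
  map_smul' := fun c s => by ext1; funext i; simp

/-- The operator of multiplication by a function. -/
noncomputable def opFun {Ω : TopologicalSpace.Opens (ℝ × ℝ)} (a : SmoothFn Ω) : PsiOp Ω where
  toFun := fun s => a • s
  map_add' := fun s s' => smul_add a s s'
  map_smul' := fun c s => by ext1; funext i; simp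

/-- Multiplication by `λ = z⁻¹`. -/
noncomputable def opLambda (Ω : TopologicalSpace.Opens (ℝ × ℝ)) : PsiOp Ω where
  toFun := fun s => HahnSeries.single (-1 : ℤ) (1 : SmoothFn Ω) * s
  map_add' := fun s s' => mul_add _ s s'
  map_smul' := fun c s => by ext1; funext i; simp [HahnSeries.coeff_single_mul]

/-- The operator `D`. -/
noncomputable def opD (Ω : TopologicalSpace.Opens (ℝ × ℝ)) : PsiOp Ω :=
  coeffDeriv (dx Ω) + opLambda Ω

/-- The operator `∂/∂t`. -/
noncomputable def opDt (Ω : TopologicalSpace.Opens (ℝ × ℝ)) : PsiOp Ω := coeffDeriv (dt Ω)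

theorem opD_coeff {Ω : TopologicalSpace.Opens (ℝ × ℝ)} (s : SymbolSeries Ω) (i : ℤ) :
    (opD Ω s).coeff i = dx Ω (s.coeff i) + s.coeff (i + 1) := by
  simp [opD, coeffDeriv, opLambda, HahnSeries.coeff_single_mul]

theorem exists_coeff_eq_zero {Ω : TopologicalSpace.Opens (ℝ × ℝ)} (s : SymbolSeries Ω) :
    ∃ b : ℤ, ∀ i < b, s.coeff i = 0 :=
  ⟨s.order, fun _ hi => HahnSeries.coeff_eq_zero_of_lt_order hi⟩

/-- The coefficients of `D⁻¹ s`, where `D⁻¹ = ∑_k (-1)^k z^{k+1} ∂_x^k`. -/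
noncomputable def dInvCoeff {Ω : TopologicalSpace.Opens (ℝ × ℝ)} (s : SymbolSeries Ω) (i : ℤ) :
    SmoothFn Ω :=
  ∑ᶠ k : ℕ, (-1 : ℂ) ^ k • (dx Ω)^[k] (s.coeff (i - 1 - k))

theorem dx_iterate_zero {Ω : TopologicalSpace.Opens (ℝ × ℝ)} (k : ℕ) :
    (dx Ω)^[k] (0 : SmoothFn Ω) = 0 := by
  induction k with
  | zero => rfl
  | succ k ih => rw [Function.iterate_succ_apply, map_zero, ih]

theorem dInvCoeff_eq_sum {Ω : TopologicalSpace.Opens (ℝ × ℝ)} (s : SymbolSeries Ω) (b : ℤ)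
    (hb : ∀ i < b, s.coeff i = 0) (i : ℤ) (n : ℕ) (hn : i - b ≤ n) :
    dInvCoeff s i =
      ∑ k ∈ Finset.range n, (-1 : ℂ) ^ k • (dx Ω)^[k] (s.coeff (i - 1 - k)) := by
  refine finsum_eq_sum_of_support_subset _ fun k hk => ?_
  rw [Finset.coe_range, Set.mem_Iio]
  by_contra hkn
  apply hk
  have hs : s.coeff (i - 1 - k) = 0 := hb _ (by omega)
  simp only [hs, dx_iterate_zero, smul_zero]

/-- The operator `D⁻¹`. -/
noncomputable def opDInv (Ω : TopologicalSpace.Opens (ℝ × ℝ)) : PsiOp Ω where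
  toFun := fun s => HahnSeries.ofSuppBddBelow (dInvCoeff s) (by
    obtain ⟨b, hb⟩ := exists_coeff_eq_zero s
    refine ⟨b, fun i hi => ?_⟩
    by_contra hib
    apply hi
    rw [dInvCoeff_eq_sum s b hb i 0 (by push_cast; omega), Finset.sum_range_zero])
  map_add' := fun s s' => by
    obtain ⟨b, hb⟩ := exists_coeff_eq_zero s
    obtain ⟨b', hb'⟩ := exists_coeff_eq_zero s'
    ext1; funext i
    have h1 : ∀ j < min b b', s.coeff j = 0 := fun j hj => hb j (by omega)
    have h2 : ∀ j < min b b', s'.coeff j = 0 := fun j hj => hb' j (by omega)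
    have h3 : ∀ j < min b b', (s + s').coeff j = 0 := fun j hj => by
      rw [HahnSeries.coeff_add, h1 j hj, h2 j hj, add_zero]
    have hn : i - min b b' ≤ ((i - min b b').toNat : ℕ) := Int.self_le_toNat _
    simp only [HahnSeries.coeff_add, HahnSeries.coeff_ofSuppBddBelow]
    rw [dInvCoeff_eq_sum _ _ h1 i _ hn, dInvCoeff_eq_sum _ _ h2 i _ hn,
      dInvCoeff_eq_sum _ _ h3 i _ hn, ← Finset.sum_add_distrib]
    refine Finset.sum_congr rfl fun k _ => ?_
    rw [← smul_add, HahnSeries.coeff_add, iterate_map_add]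
  map_smul' := fun c s => by
    obtain ⟨b, hb⟩ := exists_coeff_eq_zero s
    ext1; funext i
    have h1 : ∀ j < b, (c • s).coeff j = 0 := fun j hj => by
      rw [HahnSeries.coeff_smul, hb j hj, smul_zero]
    have hn : i - b ≤ ((i - b).toNat : ℕ) := Int.self_le_toNat _
    simp only [RingHom.id_apply, HahnSeries.coeff_smul, HahnSeries.coeff_ofSuppBddBelow]
    rw [dInvCoeff_eq_sum _ _ hb i _ hn, dInvCoeff_eq_sum _ _ h1 i _ hn, Finset.smul_sum]
    refine Finset.sum_congr rfl fun k _ => ?_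
    have h2 : ∀ f : SmoothFn Ω, (dx Ω)^[k] (c • f) = c • (dx Ω)^[k] f := fun f =>
      (Function.Commute.iterate_left (fun g => (dx Ω).map_smul c g) k) f
    rw [HahnSeries.coeff_smul, h2, smul_comm]

theorem opD_mul_opDInv (Ω : TopologicalSpace.Opens (ℝ × ℝ)) : opD Ω * opDInv Ω = 1 := by
  apply LinearMap.ext; intro s
  obtain ⟨b, hb⟩ := exists_coeff_eq_zero s
  ext1; funext i
  have hn : i - b ≤ ((i - b).toNat : ℕ) := Int.self_le_toNat _
  have h : (opD Ω (opDInv Ω s)).coeff i = dx Ω (dInvCoeff s i) + dInvCoeff s (i + 1) := by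
    rw [opD_coeff]; rfl
  rw [Module.End.mul_apply, h, dInvCoeff_eq_sum _ _ hb i _ hn,
    dInvCoeff_eq_sum _ _ hb (i + 1) ((i - b).toNat + 1) (by push_cast; omega),
    Finset.sum_range_succ', map_sum, ← add_assoc, ← Finset.sum_add_distrib,
    Finset.sum_eq_zero]
  · simp
  · intro k _
    have e : i + 1 - 1 - ((k + 1 : ℕ) : ℤ) = i - 1 - k := by push_cast; ring
    rw [e, Function.iterate_succ_apply', (dx Ω).map_smul, pow_succ, ← add_smul]
    simp

theorem opDInv_mul_opD (Ω : TopologicalSpace.Opens (ℝ × ℝ)) : opDInv Ω * opD Ω = 1 := by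
  have inj : Function.Injective (opD Ω) := by
    rw [injective_iff_map_eq_zero]
    intro s hs
    obtain ⟨b, hb⟩ := exists_coeff_eq_zero s
    have key : ∀ n : ℕ, ∀ i < b + n, s.coeff i = 0 := by
      intro n
      induction n with
      | zero => simpa using hb
      | succ n ih =>
        intro i hi
        have h := opD_coeff s (i - 1)
        rw [hs, ih (i - 1) (by push_cast at hi; omega)] at h
        simpa using h.symm
    ext1; funext i
    exact key ((i - b).toNat + 1) i (by have := Int.self_le_toNat (i - b); push_cast; omega)
  apply LinearMap.ext; intro s
  apply inj
  have h := LinearMap.congr_fun (opD_mul_opDInv Ω) (opD Ω s)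
  simpa only [Module.End.mul_apply, Module.End.one_apply] using h

/-- The Leibniz rule `D a = a D + a_x`. -/
theorem opD_mul_opFun {Ω : TopologicalSpace.Opens (ℝ × ℝ)} (a : SmoothFn Ω) :
    opD Ω * opFun a = opFun a * opD Ω + opFun (dx Ω a) := by
  apply LinearMap.ext; intro s
  ext1; funext i
  have h1 : (opD Ω (opFun a s)).coeff i = dx Ω (a * s.coeff i) + a * s.coeff (i + 1) := by
    rw [opD_coeff]; rfl
  have h2 : (opFun a (opD Ω s)).coeff i = a * (dx Ω (s.coeff i) + s.coeff (i + 1)) := by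
    rw [← opD_coeff]; rfl
  have h3 : (opFun (dx Ω a) s).coeff i = dx Ω a * s.coeff i := rfl
  simp only [Module.End.mul_apply, LinearMap.add_apply, HahnSeries.coeff_add, h1, h2, h3,
    Derivation.leibniz, smul_eq_mul]
  ring

/-! ### Matrix integro-differential operators -/

/-- A nonlocal term `h D⁻¹ gᵀ`, with `N × p` matrix functions `h` and `g`. -/
structure NonlocalTerm (Ω : TopologicalSpace.Opens (ℝ × ℝ)) (N : ℕ) where
  p : ℕ
  h : Matrix (Fin N) (Fin p) (SmoothFn Ω)
  g : Matrix (Fin N) (Fin p) (SmoothFn Ω)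

/-- The expression `a ∂_t + ∑_{i ≤ ord} u_i D^i + ∑_{τ ∈ tail} h_τ D⁻¹ g_τᵀ`, with `a ∈ ℂ`. -/
structure IntDiffExpr (Ω : TopologicalSpace.Opens (ℝ × ℝ)) (N : ℕ) where
  a : ℂ
  ord : ℕ
  u : ℕ → Matrix (Fin N) (Fin N) (SmoothFn Ω)
  tail : List (NonlocalTerm Ω N)

/-- A matrix function as a multiplication operator. -/
noncomputable def mulOp {Ω : TopologicalSpace.Opens (ℝ × ℝ)} {m n : ℕ}
    (F : Matrix (Fin m) (Fin n) (SmoothFn Ω)) : Matrix (Fin m) (Fin n) (PsiOp Ω) :=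
  F.map opFun

/-- A constant matrix as a matrix function. -/
noncomputable def constMat (Ω : TopologicalSpace.Opens (ℝ × ℝ)) {m n : ℕ}
    (F : Matrix (Fin m) (Fin n) ℂ) : Matrix (Fin m) (Fin n) (SmoothFn Ω) :=
  F.map (algebraMap ℂ (SmoothFn Ω))

namespace IntDiffExpr

variable {Ω : TopologicalSpace.Opens (ℝ × ℝ)} {N : ℕ}

/-- The element of the operator algebra that the expression denotes. -/
noncomputable def toOp (P : IntDiffExpr Ω N) : Matrix (Fin N) (Fin N) (PsiOp Ω) :=
  P.a • Matrix.scalar (Fin N) (opDt Ω)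
    + ∑ i ∈ Finset.range (P.ord + 1), mulOp (P.u i) * Matrix.scalar (Fin N) (opD Ω ^ i)
    + (P.tail.map fun τ =>
        mulOp τ.h * Matrix.scalar (Fin τ.p) (opDInv Ω) * mulOp τ.g.transpose).sum

/-- The action `P{f}` on a matrix function `f`. -/
noncomputable def apply (𝓒 : FunctionClass Ω) (P : IntDiffExpr Ω N) {p : ℕ}
    (f : Matrix (Fin N) (Fin p) (SmoothFn Ω)) : Matrix (Fin N) (Fin p) (SmoothFn Ω) :=
  P.a • f.map (dt Ω)
    + ∑ i ∈ Finset.range (P.ord + 1), P.u i * f.map (dx Ω)^[i]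
    + (P.tail.map fun τ => τ.h * (τ.g.transpose * f).map 𝓒.dInv).sum

/-- The action `P^τ{f}` of the formal transpose
`P^τ = -a ∂_t + ∑ (-1)^i D^i u_iᵀ - ∑ g D⁻¹ hᵀ`. -/
noncomputable def applyT (𝓒 : FunctionClass Ω) (P : IntDiffExpr Ω N) {p : ℕ}
    (f : Matrix (Fin N) (Fin p) (SmoothFn Ω)) : Matrix (Fin N) (Fin p) (SmoothFn Ω) :=
  -(P.a • f.map (dt Ω))
    + ∑ i ∈ Finset.range (P.ord + 1), (-1 : ℂ) ^ i • ((P.u i).transpose * f).map (dx Ω)^[i]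
    - (P.tail.map fun τ => τ.g * (τ.h.transpose * f).map 𝓒.dInv).sum

end IntDiffExpr

/-- `(X)_{≥0} = ∑_{i ≤ k} u_i D^i`: the operator `X` is this differential operator plus nonlocal
terms `h D⁻¹ gᵀ`. -/
def HasDiffPart {Ω : TopologicalSpace.Opens (ℝ × ℝ)} {N : ℕ}
    (X : Matrix (Fin N) (Fin N) (PsiOp Ω)) (k : ℕ)
    (u : ℕ → Matrix (Fin N) (Fin N) (SmoothFn Ω)) : Prop :=
  ∃ T : List (NonlocalTerm Ω N), X = (IntDiffExpr.mk 0 k u T).toOp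

/-- The coefficients of a differential operator of order `k` with constant leading coefficient
`J` and lower coefficients `u 0, …, u (k - 1)`. -/
noncomputable def withLead {Ω : TopologicalSpace.Opens (ℝ × ℝ)} {N : ℕ} (k : ℕ)
    (J : Matrix (Fin N) (Fin N) ℂ) (u : ℕ → Matrix (Fin N) (Fin N) (SmoothFn Ω)) (i : ℕ) :
    Matrix (Fin N) (Fin N) (SmoothFn Ω) :=
  if i = k then constMat Ω J else u i

/-- The differential operator `J D^k + ∑_{i < k} u_i D^i`. -/
noncomputable def diffExpr {Ω : TopologicalSpace.Opens (ℝ × ℝ)} {N : ℕ} (k : ℕ)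
    (J : Matrix (Fin N) (Fin N) ℂ) (u : ℕ → Matrix (Fin N) (Fin N) (SmoothFn Ω)) :
    IntDiffExpr Ω N :=
  ⟨0, k, withLead k J u, []⟩

/-- `M = α ∂_t - (J D^n + ∑_{i < n} v_i D^i) + nonlocal terms`. -/
noncomputable def evolExpr {Ω : TopologicalSpace.Opens (ℝ × ℝ)} {N : ℕ} (α : ℂ) (n : ℕ)
    (J : Matrix (Fin N) (Fin N) ℂ) (v : ℕ → Matrix (Fin N) (Fin N) (SmoothFn Ω))
    (T : List (NonlocalTerm Ω N)) : IntDiffExpr Ω N :=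
  ⟨α, n, fun i => -withLead n J v i, T⟩

/-- The list of the terms `c q[j] S D⁻¹ rᵀ[l-j]`, `j = 0, …, l`, where `q[j] = M^j{q}` and
`r[j] = (M^τ)^j{r}`. -/
noncomputable def chainTerms {Ω : TopologicalSpace.Opens (ℝ × ℝ)} {N p : ℕ}
    (𝓒 : FunctionClass Ω) (M : IntDiffExpr Ω N) (c : ℂ) (l : ℕ)
    (q r : Matrix (Fin N) (Fin p) (SmoothFn Ω)) (S : Matrix (Fin p) (Fin p) ℂ) :
    List (NonlocalTerm Ω N) :=
  (List.range (l + 1)).map fun j =>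
    ⟨p, c • ((M.apply 𝓒)^[j] q * constMat Ω S), (M.applyT 𝓒)^[l - j] r⟩

/-! ### The binary Darboux transformation -/

/-- `Δ = C + D⁻¹{ψᵀ φ}`. -/
noncomputable def bdtDelta {Ω : TopologicalSpace.Opens (ℝ × ℝ)} {N K : ℕ} (𝓒 : FunctionClass Ω)
    (φ ψ : Matrix (Fin N) (Fin K) (SmoothFn Ω)) (C : Matrix (Fin K) (Fin K) ℂ) :
    Matrix (Fin K) (Fin K) (SmoothFn Ω) :=
  constMat Ω C + (ψ.transpose * φ).map 𝓒.dInv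

/-- `W = I - φ Δ⁻¹ D⁻¹ ψᵀ`. -/
noncomputable def bdt {Ω : TopologicalSpace.Opens (ℝ × ℝ)} {N K : ℕ} (𝓒 : FunctionClass Ω)
    (φ ψ : Matrix (Fin N) (Fin K) (SmoothFn Ω)) (C : Matrix (Fin K) (Fin K) ℂ) :
    IntDiffExpr Ω N :=
  ⟨0, 0, fun _ => 1, [⟨K, -(φ * (bdtDelta 𝓒 φ ψ C)⁻¹), ψ⟩]⟩

/-- `W⁻¹ = I + φ D⁻¹ Δ⁻¹ ψᵀ`. -/
noncomputable def bdtInv {Ω : TopologicalSpace.Opens (ℝ × ℝ)} {N K : ℕ} (𝓒 : FunctionClass Ω)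
    (φ ψ : Matrix (Fin N) (Fin K) (SmoothFn Ω)) (C : Matrix (Fin K) (Fin K) ℂ) :
    IntDiffExpr Ω N :=
  ⟨0, 0, fun _ => 1, [⟨K, φ, ψ * ((bdtDelta 𝓒 φ ψ C)⁻¹).transpose⟩]⟩

/-! ### Commuting derivatives -/

/-! A formal operator does not determine its action on functions, because `D⁻¹{·}` involves a choice
of antiderivative. The argument therefore runs in the ring `OpAct`, whose elements bundle a formal
operator, an action on the right class and a transposed action on the left class, the last with
reversed multiplication. Once the elementary product rules hold in all three components, in
particular `nonloc_mul_nonloc` (integration by parts), everything else is ring algebra.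

With `V = I + φ D⁻¹ Ψᵀ`, integration by parts and `D⁻¹{ψᵀφ} = Δ - C`, `D⁻¹{ΨᵀΦ} = C⁻¹ - Δ⁻¹` give
`WV = VW = 1`, and also `W{φ} = ΦC`, `V^τ{ψ} = ΨCᵀ`. Conjugating any of the building blocks produces
the expected dressed block plus the same additive expression, `correction X = W{X{φ}} D⁻¹ Ψᵀ - Φ D⁻¹
(V^τ{X^τ{ψ}})ᵀ`. This is `conj_evol`, `exists_conj_diffOp` and `conj_nonloc`. By additivity the
corrections of all the terms of `M` or `L` add up to that of the whole operator.

If `X{φ} = φA` and `X^τ{ψ} = ψB`, the correction collapses to `Φ(CA - BᵀC)D⁻¹Ψᵀ`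
(`correction_of_eigen`). For `M` this is the term with `M₁`. For `L`, the equations for `L +
cM^(l+1)` force `A = -cΛ^(l+1)` and `B = -cΛ̃^(l+1)`. Since `Φ[s] = ΦCΛ^sC⁻¹` and `Ψ[s] =
ΨCᵀΛ̃^s(C⁻¹)ᵀ`, the chain of products `Φ[s]M₁D⁻¹Ψᵀ[l-s]` telescopes to exactly this power difference
(`chainOp_Φ_Ψ`). The identity for `L + cM^(l+1)` holds because conjugation respects powers. -/

theorem extendZero_dirDeriv {Ω : TopologicalSpace.Opens (ℝ × ℝ)} (w : ℝ × ℝ) (f : SmoothFn Ω)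
    {p : ℝ × ℝ} (hp : p ∈ Ω) :
    extendZero Ω (dirDeriv Ω w f).1 p = fderiv ℝ (extendZero Ω f.1) p w :=
  extendZero_coe Ω _ ⟨p, hp⟩

theorem dirDeriv_comm {Ω : TopologicalSpace.Opens (ℝ × ℝ)} (w w' : ℝ × ℝ) (f : SmoothFn Ω) :
    dirDeriv Ω w (dirDeriv Ω w' f) = dirDeriv Ω w' (dirDeriv Ω w f) := by
  have key : ∀ (a b : ℝ × ℝ) (p : Ω), (dirDeriv Ω a (dirDeriv Ω b f)).1 p
      = fderiv ℝ (fderiv ℝ (extendZero Ω f.1)) p a b := by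
    intro a b p
    have hf : ContDiffAt ℝ ∞ (extendZero Ω f.1) p :=
      (f.2 : ContDiffOn ℝ ∞ (extendZero Ω f.1) Ω).contDiffAt (Ω.isOpen.mem_nhds p.2)
    have hd : DifferentiableAt ℝ (fderiv ℝ (extendZero Ω f.1)) p :=
      (hf.fderiv_right (m := 1) (by norm_cast)).differentiableAt (by simp)
    -- The two functions are compared only near `p`: outside `Ω` the extension by zero need not
    -- agree with the derivative.
    have he : extendZero Ω (dirDeriv Ω b f).1
        =ᶠ[nhds (p : ℝ × ℝ)] fun x => fderiv ℝ (extendZero Ω f.1) x b := by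
      filter_upwards [Ω.isOpen.mem_nhds p.2] with x hx
      exact extendZero_dirDeriv b f hx
    change fderiv ℝ (extendZero Ω (dirDeriv Ω b f).1) p a = _
    rw [he.fderiv_eq, fderiv_clm_apply hd (differentiableAt_const b)]
    simp
  apply Subtype.ext; funext p
  rw [key, key]
  have hf : ContDiffAt ℝ ∞ (extendZero Ω f.1) p :=
    (f.2 : ContDiffOn ℝ ∞ (extendZero Ω f.1) Ω).contDiffAt (Ω.isOpen.mem_nhds p.2)
  exact (hf.isSymmSndFDerivAt (by simp only [minSmoothness_of_isRCLikeNormedField]; norm_cast)).eq w w'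

theorem dx_dt_comm {Ω : TopologicalSpace.Opens (ℝ × ℝ)} (f : SmoothFn Ω) :
    dx Ω (dt Ω f) = dt Ω (dx Ω f) :=
  dirDeriv_comm _ _ f

section Development

noncomputable local instance (Ω : TopologicalSpace.Opens (ℝ × ℝ)) : CommRing (SmoothFn Ω) :=
  Subalgebra.toCommRing _

noncomputable local instance {Ω : TopologicalSpace.Opens (ℝ × ℝ)} (𝓒 : FunctionClass Ω) :
    CommRing 𝓒.coeff :=
  Subalgebra.toCommRing _

noncomputable local instance {Ω : TopologicalSpace.Opens (ℝ × ℝ)} (𝓒 : FunctionClass Ω) :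
    Algebra ℂ 𝓒.coeff :=
  Subalgebra.algebra _

/-! ### Antiderivatives in a function class -/

namespace FunctionClass

variable {Ω : TopologicalSpace.Opens (ℝ × ℝ)} (𝓒 : FunctionClass Ω)

theorem exists_antideriv {f : SmoothFn Ω} (hf : f ∈ 𝓒.decay) :
    ∃ F ∈ (𝓒.decay : Set (SmoothFn Ω)), dx Ω F = f :=
  𝓒.dx_bijOn.surjOn hf

theorem dInv_mem {f : SmoothFn Ω} (hf : f ∈ 𝓒.decay) : 𝓒.dInv f ∈ 𝓒.decay :=
  Function.invFunOn_mem (𝓒.exists_antideriv hf)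

theorem dx_dInv {f : SmoothFn Ω} (hf : f ∈ 𝓒.decay) : dx Ω (𝓒.dInv f) = f :=
  Function.invFunOn_eq (𝓒.exists_antideriv hf)

/-- Injectivity of `∂/∂x` on `decay` fixes the integration constant. Every later identity between
antiderivatives reduces to membership in `decay` and a comparison of derivatives. -/
theorem eq_dInv {f F : SmoothFn Ω} (hF : F ∈ 𝓒.decay) (h : dx Ω F = f) : F = 𝓒.dInv f := by
  have hf : f ∈ 𝓒.decay := h ▸ 𝓒.dx_bijOn.mapsTo hF
  exact 𝓒.dx_bijOn.injOn hF (𝓒.dInv_mem hf) (h.trans (𝓒.dx_dInv hf).symm)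

theorem coeff_mul_mem {S : Submodule 𝓒.coeff (SmoothFn Ω)} {a f : SmoothFn Ω}
    (ha : a ∈ 𝓒.coeff) (hf : f ∈ S) : a * f ∈ S :=
  S.smul_mem ⟨a, ha⟩ hf

end FunctionClass

/-! ### Matrices over a function class -/

section Matrices

variable {Ω : TopologicalSpace.Opens (ℝ × ℝ)} {𝓒 : FunctionClass Ω}

theorem map_derivation_mul {l m n : ℕ} (d : Derivation ℂ (SmoothFn Ω) (SmoothFn Ω))
    (A : Matrix (Fin l) (Fin m) (SmoothFn Ω)) (B : Matrix (Fin m) (Fin n) (SmoothFn Ω)) :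
    (A * B).map d = A.map d * B + A * B.map d := by
  ext1 i j
  simp only [Matrix.map_apply, Matrix.mul_apply, Matrix.add_apply, map_sum, Derivation.leibniz,
    smul_eq_mul, ← Finset.sum_add_distrib]
  exact Finset.sum_congr rfl fun k _ => by ring

/-- The matrices with entries in `S`. -/
noncomputable def entries (S : Submodule 𝓒.coeff (SmoothFn Ω)) (N p : ℕ) :
    AddSubgroup (Matrix (Fin N) (Fin p) (SmoothFn Ω)) where
  carrier := {f | ∀ a b, f a b ∈ S}
  zero_mem' := fun _ _ => S.zero_mem
  add_mem' := fun hf hg a b => S.add_mem (hf a b) (hg a b)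
  neg_mem' := fun {f} hf a b => by
    have h := S.neg_mem (hf a b)
    exact h

theorem entry_mem {S : Submodule 𝓒.coeff (SmoothFn Ω)} {N p : ℕ} (h : entries S N p) (a : Fin N)
    (b : Fin p) : h.1 a b ∈ S := by
  have h2 := h.2
  exact h2 a b

theorem mul_entries_mem {S : Submodule 𝓒.coeff (SmoothFn Ω)} {l m n : ℕ}
    {A : Matrix (Fin l) (Fin m) (SmoothFn Ω)} {B : Matrix (Fin m) (Fin n) (SmoothFn Ω)}
    (hA : ∀ i j, A i j ∈ 𝓒.coeff) (hB : ∀ i j, B i j ∈ S) (i : Fin l) (j : Fin n) :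
    (A * B) i j ∈ S := by
  rw [Matrix.mul_apply]
  exact S.sum_mem fun k _ => 𝓒.coeff_mul_mem (hA i k) (hB k j)

theorem mul_entries_mem' {S : Submodule 𝓒.coeff (SmoothFn Ω)} {l m n : ℕ}
    {A : Matrix (Fin l) (Fin m) (SmoothFn Ω)} {B : Matrix (Fin m) (Fin n) (SmoothFn Ω)}
    (hA : ∀ i j, A i j ∈ S) (hB : ∀ i j, B i j ∈ 𝓒.coeff) (i : Fin l) (j : Fin n) :
    (A * B) i j ∈ S := by
  rw [Matrix.mul_apply]
  refine S.sum_mem fun k _ => ?_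
  rw [mul_comm]
  exact 𝓒.coeff_mul_mem (hB k j) (hA i k)

variable (𝓒) in
/-- Matrices over the class `right`. -/
abbrev RightMat (N p : ℕ) : Type := entries 𝓒.right N p

variable (𝓒) in
/-- Matrices over the class `left`. -/
abbrev LeftMat (N p : ℕ) : Type := entries 𝓒.left N p

variable (𝓒) in
/-- Matrices over the algebra of coefficients. -/
abbrev CoeffMat (N p : ℕ) : Type := Matrix (Fin N) (Fin p) 𝓒.coeff

/-- The underlying matrix of functions. -/
noncomputable def rawMat {N p : ℕ} (A : CoeffMat 𝓒 N p) : Matrix (Fin N) (Fin p) (SmoothFn Ω) :=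
  A.map 𝓒.coeff.val

theorem rawMat_injective {N p : ℕ} :
    Function.Injective (rawMat : CoeffMat 𝓒 N p → Matrix (Fin N) (Fin p) (SmoothFn Ω)) := by
  intro A B h
  ext1 i j
  exact Subtype.ext (congrFun (congrFun h i) j)

theorem rawMat_mem {N p : ℕ} (A : CoeffMat 𝓒 N p) (i : Fin N) (j : Fin p) :
    rawMat A i j ∈ 𝓒.coeff :=
  (A i j).2

theorem exists_rawMat {N p : ℕ} {A : Matrix (Fin N) (Fin p) (SmoothFn Ω)}
    (hA : ∀ i j, A i j ∈ 𝓒.coeff) : ∃ B : CoeffMat 𝓒 N p, rawMat B = A :=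
  ⟨fun i j => ⟨A i j, hA i j⟩, rfl⟩

@[simp] theorem rawMat_mul {l m n : ℕ} (A : CoeffMat 𝓒 l m) (B : CoeffMat 𝓒 m n) :
    rawMat (A * B) = rawMat A * rawMat B :=
  Matrix.map_mul

@[simp] theorem rawMat_add {l m : ℕ} (A B : CoeffMat 𝓒 l m) :
    rawMat (A + B) = rawMat A + rawMat B := rfl

@[simp] theorem rawMat_sub {l m : ℕ} (A B : CoeffMat 𝓒 l m) :
    rawMat (A - B) = rawMat A - rawMat B := rfl

@[simp] theorem rawMat_neg {l m : ℕ} (A : CoeffMat 𝓒 l m) : rawMat (-A) = -rawMat A := rfl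

@[simp] theorem rawMat_one {l : ℕ} : rawMat (1 : CoeffMat 𝓒 l l) = 1 :=
  Matrix.map_one _ (map_zero _) (map_one _)

@[simp] theorem rawMat_transpose {l m : ℕ} (A : CoeffMat 𝓒 l m) :
    rawMat A.transpose = (rawMat A).transpose := rfl

variable (𝓒) in
/-- A constant matrix, as a matrix of coefficients. -/
noncomputable def constCoeff {l m : ℕ} (S : Matrix (Fin l) (Fin m) ℂ) : CoeffMat 𝓒 l m :=
  S.map (algebraMap ℂ 𝓒.coeff)

@[simp] theorem rawMat_constCoeff {l m : ℕ} (S : Matrix (Fin l) (Fin m) ℂ) :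
    rawMat (constCoeff 𝓒 S) = constMat Ω S := rfl

theorem constCoeff_mul {l m n : ℕ} (S : Matrix (Fin l) (Fin m) ℂ) (T : Matrix (Fin m) (Fin n) ℂ) :
    constCoeff 𝓒 (S * T) = constCoeff 𝓒 S * constCoeff 𝓒 T :=
  Matrix.map_mul

theorem constCoeff_sub {l m : ℕ} (S T : Matrix (Fin l) (Fin m) ℂ) :
    constCoeff 𝓒 (S - T) = constCoeff 𝓒 S - constCoeff 𝓒 T :=
  Matrix.map_sub _ (map_sub _) S T

theorem constCoeff_one {l : ℕ} : constCoeff 𝓒 (1 : Matrix (Fin l) (Fin l) ℂ) = 1 :=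
  Matrix.map_one _ (map_zero _) (map_one _)

theorem constCoeff_transpose {l m : ℕ} (S : Matrix (Fin l) (Fin m) ℂ) :
    constCoeff 𝓒 S.transpose = (constCoeff 𝓒 S).transpose := rfl

theorem constMat_map_derivation {l m : ℕ} (d : Derivation ℂ (SmoothFn Ω) (SmoothFn Ω))
    (S : Matrix (Fin l) (Fin m) ℂ) : (constMat Ω S).map d = 0 := by
  ext1 i j; simp [constMat]

/-! ### Multiplication of class-valued matrices by coefficient matrices -/

section Entries

variable {S : Submodule 𝓒.coeff (SmoothFn Ω)} {N p p' p'' : ℕ}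

/-- Multiplication by a matrix of coefficients from the left. -/
noncomputable def lmul (u : CoeffMat 𝓒 N N) (h : entries S N p) : entries S N p :=
  ⟨rawMat u * h.1, mul_entries_mem (rawMat_mem u) (entry_mem h)⟩

/-- Multiplication by a matrix of coefficients from the right. -/
noncomputable def rmul (h : entries S N p) (A : CoeffMat 𝓒 p p') : entries S N p' :=
  ⟨h.1 * rawMat A, mul_entries_mem' (entry_mem h) (rawMat_mem A)⟩

@[simp] theorem coe_lmul (u : CoeffMat 𝓒 N N) (h : entries S N p) :
    (lmul u h).1 = rawMat u * h.1 := rfl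

@[simp] theorem coe_rmul (h : entries S N p) (A : CoeffMat 𝓒 p p') :
    (rmul h A).1 = h.1 * rawMat A := rfl

theorem rmul_rmul (h : entries S N p) (A : CoeffMat 𝓒 p p') (B : CoeffMat 𝓒 p' p'') :
    rmul (rmul h A) B = rmul h (A * B) :=
  Subtype.ext (by simp [Matrix.mul_assoc])

theorem rmul_add (h : entries S N p) (A B : CoeffMat 𝓒 p p') :
    rmul h (A + B) = rmul h A + rmul h B :=
  Subtype.ext (by simp [Matrix.mul_add])

theorem rmul_sub (h : entries S N p) (A B : CoeffMat 𝓒 p p') :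
    rmul h (A - B) = rmul h A - rmul h B :=
  Subtype.ext (by simp [Matrix.mul_sub])

theorem rmul_neg (h : entries S N p) (A : CoeffMat 𝓒 p p') : rmul h (-A) = -rmul h A :=
  Subtype.ext (by simp)

theorem rmul_one (h : entries S N p) : rmul h (1 : CoeffMat 𝓒 p p) = h :=
  Subtype.ext (by simp)

theorem add_rmul (h h' : entries S N p) (A : CoeffMat 𝓒 p p') :
    rmul (h + h') A = rmul h A + rmul h' A :=
  Subtype.ext (by simp [Matrix.add_mul])

theorem neg_rmul (h : entries S N p) (A : CoeffMat 𝓒 p p') : rmul (-h) A = -rmul h A :=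
  Subtype.ext (by simp)

theorem lmul_rmul (u : CoeffMat 𝓒 N N) (h : entries S N p) (A : CoeffMat 𝓒 p p') :
    lmul u (rmul h A) = rmul (lmul u h) A :=
  Subtype.ext (by simp [Matrix.mul_assoc])

theorem lmul_add (u : CoeffMat 𝓒 N N) (h h' : entries S N p) :
    lmul u (h + h') = lmul u h + lmul u h' :=
  Subtype.ext (by simp [Matrix.mul_add])

theorem lmul_neg (u : CoeffMat 𝓒 N N) (h : entries S N p) : lmul u (-h) = -lmul u h :=
  Subtype.ext (by simp)

theorem add_lmul (u v : CoeffMat 𝓒 N N) (h : entries S N p) :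
    lmul (u + v) h = lmul u h + lmul v h :=
  Subtype.ext (by simp [Matrix.add_mul])

theorem lmul_lmul (u v : CoeffMat 𝓒 N N) (h : entries S N p) :
    lmul u (lmul v h) = lmul (u * v) h :=
  Subtype.ext (by simp [Matrix.mul_assoc])

/-- Entrywise application of a derivation that preserves `S`. -/
noncomputable def mapDer (d : Derivation ℂ (SmoothFn Ω) (SmoothFn Ω)) (hd : ∀ f ∈ S, d f ∈ S) :
    entries S N p →+ entries S N p where
  toFun := fun h => ⟨h.1.map d, fun a b => hd _ (entry_mem h a b)⟩
  map_zero' := Subtype.ext (by ext1 a b; simp)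
  map_add' := fun h h' => Subtype.ext (by ext1 a b; simp)

@[simp] theorem coe_mapDer (d : Derivation ℂ (SmoothFn Ω) (SmoothFn Ω)) (hd : ∀ f ∈ S, d f ∈ S)
    (h : entries S N p) : (mapDer d hd h).1 = h.1.map d := rfl

end Entries

/-! ### The potential `D⁻¹{gᵀ h}` -/

variable {N p p' p'' : ℕ}

theorem left_mul_right_mem (g : LeftMat 𝓒 N p) (h : RightMat 𝓒 N p') (i : Fin p) (j : Fin p') :
    (g.1.transpose * h.1) i j ∈ 𝓒.decay := by
  rw [Matrix.mul_apply]
  exact 𝓒.decay.sum_mem fun a _ => 𝓒.mul_mem _ (entry_mem g a i) _ (entry_mem h a j)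

/-- The matrix `gᵀ h`. -/
noncomputable def pairing (g : LeftMat 𝓒 N p) (h : RightMat 𝓒 N p') : CoeffMat 𝓒 p p' :=
  fun i j => ⟨(g.1.transpose * h.1) i j, 𝓒.decay_le _ (left_mul_right_mem g h i j)⟩

/-- The matrix `D⁻¹{gᵀ h}`. -/
noncomputable def pot (g : LeftMat 𝓒 N p) (h : RightMat 𝓒 N p') : CoeffMat 𝓒 p p' :=
  fun i j => ⟨𝓒.dInv ((g.1.transpose * h.1) i j),
    𝓒.decay_le _ (𝓒.dInv_mem (left_mul_right_mem g h i j))⟩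

/-- The matrix `h gᵀ`. -/
noncomputable def outer (h : RightMat 𝓒 N p) (g : LeftMat 𝓒 N p) : CoeffMat 𝓒 N N :=
  fun a b => ⟨(h.1 * g.1.transpose) a b, by
    rw [Matrix.mul_apply]
    refine 𝓒.coeff.sum_mem fun i _ => ?_
    rw [mul_comm]
    exact 𝓒.decay_le _ (𝓒.mul_mem _ (entry_mem g b i) _ (entry_mem h a i))⟩

@[simp] theorem rawMat_pairing (g : LeftMat 𝓒 N p) (h : RightMat 𝓒 N p') :
    rawMat (pairing g h) = g.1.transpose * h.1 := rfl

@[simp] theorem rawMat_outer (h : RightMat 𝓒 N p) (g : LeftMat 𝓒 N p) :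
    rawMat (outer h g) = h.1 * g.1.transpose := rfl

theorem pot_mem (g : LeftMat 𝓒 N p) (h : RightMat 𝓒 N p') (i : Fin p) (j : Fin p') :
    rawMat (pot g h) i j ∈ 𝓒.decay :=
  𝓒.dInv_mem (left_mul_right_mem g h i j)

theorem pot_map_dx (g : LeftMat 𝓒 N p) (h : RightMat 𝓒 N p') :
    (rawMat (pot g h)).map (dx Ω) = g.1.transpose * h.1 := by
  ext1 i j
  exact 𝓒.dx_dInv (left_mul_right_mem g h i j)

/-- The criterion behind all the rules for potentials below. To use it on an identity with several
terms, all terms but one potential are moved to one side. -/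
theorem eq_pot {g : LeftMat 𝓒 N p} {h : RightMat 𝓒 N p'} {A : CoeffMat 𝓒 p p'}
    (hA : ∀ i j, rawMat A i j ∈ 𝓒.decay) (hd : (rawMat A).map (dx Ω) = g.1.transpose * h.1) :
    A = pot g h := by
  ext1 i j
  exact Subtype.ext (𝓒.eq_dInv (hA i j) (congrFun (congrFun hd i) j))

theorem rawMat_mul_mem_left {A : CoeffMat 𝓒 p p'} {B : CoeffMat 𝓒 p' p''}
    (hA : ∀ i j, rawMat A i j ∈ 𝓒.decay) (i : Fin p) (j : Fin p'') :
    rawMat (A * B) i j ∈ 𝓒.decay := by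
  rw [rawMat_mul]
  exact mul_entries_mem' hA (rawMat_mem B) i j

theorem rawMat_mul_mem_right {A : CoeffMat 𝓒 p p'} {B : CoeffMat 𝓒 p' p''}
    (hB : ∀ i j, rawMat B i j ∈ 𝓒.decay) (i : Fin p) (j : Fin p'') :
    rawMat (A * B) i j ∈ 𝓒.decay := by
  rw [rawMat_mul]
  exact mul_entries_mem (rawMat_mem A) hB i j

theorem map_derivation_add {l m : ℕ} (d : Derivation ℂ (SmoothFn Ω) (SmoothFn Ω))
    (A B : Matrix (Fin l) (Fin m) (SmoothFn Ω)) : (A + B).map d = A.map d + B.map d := by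
  ext1 i j; simp

theorem map_derivation_sub {l m : ℕ} (d : Derivation ℂ (SmoothFn Ω) (SmoothFn Ω))
    (A B : Matrix (Fin l) (Fin m) (SmoothFn Ω)) : (A - B).map d = A.map d - B.map d := by
  ext1 i j; simp

theorem map_derivation_neg {l m : ℕ} (d : Derivation ℂ (SmoothFn Ω) (SmoothFn Ω))
    (A : Matrix (Fin l) (Fin m) (SmoothFn Ω)) : (-A).map d = -A.map d := by
  ext1 i j; simp

theorem pot_add_right (g : LeftMat 𝓒 N p) (h h' : RightMat 𝓒 N p') :
    pot g (h + h') = pot g h + pot g h' :=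
  (eq_pot (fun i j => 𝓒.decay.add_mem (pot_mem g h i j) (pot_mem g h' i j)) (by
    rw [rawMat_add, map_derivation_add, pot_map_dx, pot_map_dx, AddSubgroup.coe_add,
      Matrix.mul_add])).symm

theorem pot_add_left (g g' : LeftMat 𝓒 N p) (h : RightMat 𝓒 N p') :
    pot (g + g') h = pot g h + pot g' h :=
  (eq_pot (fun i j => 𝓒.decay.add_mem (pot_mem g h i j) (pot_mem g' h i j)) (by
    rw [rawMat_add, map_derivation_add, pot_map_dx, pot_map_dx, AddSubgroup.coe_add,
      Matrix.transpose_add, Matrix.add_mul])).symm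

theorem pot_neg_left (g : LeftMat 𝓒 N p) (h : RightMat 𝓒 N p') : pot (-g) h = -pot g h :=
  (eq_pot (fun i j => 𝓒.decay.neg_mem (pot_mem g h i j)) (by
    rw [rawMat_neg, map_derivation_neg, pot_map_dx, AddSubgroup.coe_neg, Matrix.transpose_neg,
      Matrix.neg_mul])).symm

theorem pot_rmul_const (g : LeftMat 𝓒 N p) (h : RightMat 𝓒 N p')
    (S : Matrix (Fin p') (Fin p'') ℂ) :
    pot g (rmul h (constCoeff 𝓒 S)) = pot g h * constCoeff 𝓒 S :=
  (eq_pot (rawMat_mul_mem_left (pot_mem g h)) (by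
    rw [rawMat_mul, map_derivation_mul, pot_map_dx, rawMat_constCoeff, constMat_map_derivation,
      coe_rmul, rawMat_constCoeff, Matrix.mul_zero, add_zero, Matrix.mul_assoc])).symm

theorem pot_rmul_const_left (g : LeftMat 𝓒 N p) (h : RightMat 𝓒 N p')
    (S : Matrix (Fin p) (Fin p'') ℂ) :
    pot (rmul g (constCoeff 𝓒 S)) h = (constCoeff 𝓒 S).transpose * pot g h :=
  (eq_pot (rawMat_mul_mem_right (pot_mem g h)) (by
    rw [rawMat_mul, map_derivation_mul, pot_map_dx, ← constCoeff_transpose, rawMat_constCoeff,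
      constMat_map_derivation, coe_rmul, rawMat_constCoeff, Matrix.zero_mul, zero_add,
      Matrix.transpose_mul, Matrix.mul_assoc]
    rfl)).symm

theorem pot_lmul (u : CoeffMat 𝓒 N N) (g : LeftMat 𝓒 N p) (h : RightMat 𝓒 N p') :
    pot (lmul u.transpose g) h = pot g (lmul u h) := by
  refine eq_pot (pot_mem _ _) ?_
  rw [pot_map_dx, coe_lmul, coe_lmul, Matrix.transpose_mul, rawMat_transpose,
    Matrix.transpose_transpose, Matrix.mul_assoc]

/-- Leibniz rule for the product of two potentials. No integration constant appears because `decay`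
is an ideal, so the product is again the distinguished antiderivative of its derivative. -/
theorem pot_mul_pot (g : LeftMat 𝓒 N p) (h : RightMat 𝓒 N p') (g' : LeftMat 𝓒 N p')
    (h' : RightMat 𝓒 N p'') :
    pot g h * pot g' h' = pot g (rmul h (pot g' h')) + pot (rmul g' (pot g h).transpose) h' := by
  have h1 : pot g h * pot g' h' - pot g (rmul h (pot g' h'))
      = pot (rmul g' (pot g h).transpose) h' := by
    refine eq_pot (fun i j => 𝓒.decay.sub_mem (rawMat_mul_mem_left (pot_mem g h) i j)
      (pot_mem _ _ i j)) ?_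
    rw [rawMat_sub, map_derivation_sub, rawMat_mul, map_derivation_mul, pot_map_dx, pot_map_dx,
      pot_map_dx, coe_rmul, coe_rmul, Matrix.transpose_mul, rawMat_transpose,
      Matrix.transpose_transpose, Matrix.mul_assoc, Matrix.mul_assoc, add_sub_cancel_left]
  rw [← h1, add_sub_cancel]

/-! ### Derivatives of class-valued matrices and of potentials -/

/-- `∂/∂x` on matrices over `right`. -/
noncomputable def dxR : RightMat 𝓒 N p →+ RightMat 𝓒 N p := mapDer (dx Ω) 𝓒.dx_right

/-- `∂/∂x` on matrices over `left`. -/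
noncomputable def dxL : LeftMat 𝓒 N p →+ LeftMat 𝓒 N p := mapDer (dx Ω) 𝓒.dx_left

theorem smul_derivation_mem {S : Submodule 𝓒.coeff (SmoothFn Ω)}
    {d : Derivation ℂ (SmoothFn Ω) (SmoothFn Ω)} (hd : ∀ f ∈ S, d f ∈ S) (α : ℂ) :
    ∀ f ∈ S, (α • d) f ∈ S := fun f hf => by
  have h := S.smul_mem (algebraMap ℂ 𝓒.coeff α) (hd f hf)
  rwa [algebraMap_smul] at h

/-- `α ∂/∂t` on matrices over `right`. -/
noncomputable def dtR (α : ℂ) : RightMat 𝓒 N p →+ RightMat 𝓒 N p :=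
  mapDer (α • dt Ω) (smul_derivation_mem 𝓒.dt_right α)

/-- `α ∂/∂t` on matrices over `left`. -/
noncomputable def dtL (α : ℂ) : LeftMat 𝓒 N p →+ LeftMat 𝓒 N p :=
  mapDer (α • dt Ω) (smul_derivation_mem 𝓒.dt_left α)

@[simp] theorem coe_dxR (h : RightMat 𝓒 N p) : (dxR h).1 = h.1.map (dx Ω) := rfl

@[simp] theorem coe_dxL (h : LeftMat 𝓒 N p) : (dxL h).1 = h.1.map (dx Ω) := rfl

@[simp] theorem coe_dtR (α : ℂ) (h : RightMat 𝓒 N p) : (dtR α h).1 = h.1.map (α • dt Ω) := rfl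

@[simp] theorem coe_dtL (α : ℂ) (h : LeftMat 𝓒 N p) : (dtL α h).1 = h.1.map (α • dt Ω) := rfl

/-- `∂/∂x` on matrices of coefficients. -/
noncomputable def dxC {p q : ℕ} (A : CoeffMat 𝓒 p q) : CoeffMat 𝓒 p q :=
  fun i j => ⟨dx Ω (A i j).1, 𝓒.dx_coeff _ (A i j).2⟩

/-- `α ∂/∂t` on matrices of coefficients. -/
noncomputable def dtC {p q : ℕ} (α : ℂ) (A : CoeffMat 𝓒 p q) : CoeffMat 𝓒 p q :=
  fun i j => ⟨(α • dt Ω) (A i j).1, 𝓒.coeff.smul_mem (𝓒.dt_coeff _ (A i j).2) α⟩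

@[simp] theorem rawMat_dxC {p q : ℕ} (A : CoeffMat 𝓒 p q) :
    rawMat (dxC A) = (rawMat A).map (dx Ω) := rfl

@[simp] theorem rawMat_dtC {p q : ℕ} (α : ℂ) (A : CoeffMat 𝓒 p q) :
    rawMat (dtC α A) = (rawMat A).map (α • dt Ω) := rfl

theorem dxC_pot (g : LeftMat 𝓒 N p) (h : RightMat 𝓒 N p') : dxC (pot g h) = pairing g h :=
  rawMat_injective (pot_map_dx g h)

theorem map_derivation_transpose {l m : ℕ} (d : Derivation ℂ (SmoothFn Ω) (SmoothFn Ω))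
    (A : Matrix (Fin l) (Fin m) (SmoothFn Ω)) : A.transpose.map d = (A.map d).transpose := rfl

/-- There is no boundary term: `gᵀh` itself lies in `decay`, hence is recovered by `D⁻¹` from its
derivative. -/
theorem pot_dx (g : LeftMat 𝓒 N p) (h : RightMat 𝓒 N p') :
    pot (dxL g) h + pot g (dxR h) = pairing g h := by
  have h1 : pairing g h - pot g (dxR h) = pot (dxL g) h := by
    refine eq_pot (fun i j => 𝓒.decay.sub_mem (left_mul_right_mem g h i j) (pot_mem _ _ i j)) ?_
    rw [rawMat_sub, map_derivation_sub, rawMat_pairing, map_derivation_mul, pot_map_dx, coe_dxR,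
      coe_dxL, add_sub_cancel_right, map_derivation_transpose]
  rw [← h1, sub_add_cancel]

theorem map_dx_dt {l m : ℕ} (α : ℂ) (A : Matrix (Fin l) (Fin m) (SmoothFn Ω)) :
    (A.map (α • dt Ω)).map (dx Ω) = (A.map (dx Ω)).map (α • dt Ω) := by
  ext1 i j
  simp [dx_dt_comm]

/-- Differentiation under the antiderivative is legitimate because `∂/∂t` commutes with `∂/∂x` and
preserves `decay`. -/
theorem pot_dt (α : ℂ) (g : LeftMat 𝓒 N p) (h : RightMat 𝓒 N p') :
    pot (dtL α g) h + pot g (dtR α h) = dtC α (pot g h) := by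
  have h1 : dtC α (pot g h) - pot g (dtR α h) = pot (dtL α g) h := by
    refine eq_pot (fun i j => 𝓒.decay.sub_mem
      (smul_derivation_mem 𝓒.dt_decay α _ (pot_mem g h i j)) (pot_mem _ _ i j)) ?_
    rw [rawMat_sub, map_derivation_sub, rawMat_dtC, map_dx_dt, pot_map_dx, map_derivation_mul,
      pot_map_dx, coe_dtR, coe_dtL, add_sub_cancel_right, map_derivation_transpose]
  rw [← h1, sub_add_cancel]

theorem dxR_rmul (h : RightMat 𝓒 N p) (A : CoeffMat 𝓒 p p') :
    dxR (rmul h A) = rmul (dxR h) A + rmul h (dxC A) :=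
  Subtype.ext (by simp [map_derivation_mul])

theorem dxL_rmul (h : LeftMat 𝓒 N p) (A : CoeffMat 𝓒 p p') :
    dxL (rmul h A) = rmul (dxL h) A + rmul h (dxC A) :=
  Subtype.ext (by simp [map_derivation_mul])

theorem dtR_rmul (α : ℂ) (h : RightMat 𝓒 N p) (A : CoeffMat 𝓒 p p') :
    dtR α (rmul h A) = rmul (dtR α h) A + rmul h (dtC α A) :=
  Subtype.ext (by simp only [coe_dtR, coe_rmul, map_derivation_mul, rawMat_dtC,
    AddSubgroup.coe_add])

theorem dtL_rmul (α : ℂ) (h : LeftMat 𝓒 N p) (A : CoeffMat 𝓒 p p') :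
    dtL α (rmul h A) = rmul (dtL α h) A + rmul h (dtC α A) :=
  Subtype.ext (by simp only [coe_dtL, coe_rmul, map_derivation_mul, rawMat_dtC,
    AddSubgroup.coe_add])

theorem dxR_lmul (u : CoeffMat 𝓒 N N) (h : RightMat 𝓒 N p) :
    dxR (lmul u h) = lmul u (dxR h) + lmul (dxC u) h :=
  Subtype.ext (by simp [map_derivation_mul, add_comm])

theorem dxL_lmul (u : CoeffMat 𝓒 N N) (h : LeftMat 𝓒 N p) :
    dxL (lmul u h) = lmul u (dxL h) + lmul (dxC u) h :=
  Subtype.ext (by simp [map_derivation_mul, add_comm])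

/-- Associativity of `h gᵀ f`. It turns the derivative of a potential into multiplication by `h gᵀ`,
the local part that arises when `D` meets `h D⁻¹ gᵀ`. -/
theorem rmul_pairing (h : RightMat 𝓒 N p) (g : LeftMat 𝓒 N p) (f : RightMat 𝓒 N p') :
    rmul h (pairing g f) = lmul (outer h g) f :=
  Subtype.ext (by simp [Matrix.mul_assoc])

theorem rmul_pairing_transpose (h : RightMat 𝓒 N p) (g : LeftMat 𝓒 N p) (f : LeftMat 𝓒 N p') :
    rmul g (pairing f h).transpose = lmul (outer h g).transpose f :=
  Subtype.ext (by simp [Matrix.mul_assoc])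

end Matrices

/-! ### Operator identities -/

noncomputable local instance (Ω : TopologicalSpace.Opens (ℝ × ℝ)) : Ring (PsiOp Ω) := Module.End.instRing

noncomputable local instance (Ω : TopologicalSpace.Opens (ℝ × ℝ)) :
    AddCommGroup (PsiOp Ω) := Ring.toAddCommGroup

noncomputable local instance (Ω : TopologicalSpace.Opens (ℝ × ℝ)) : Sub (PsiOp Ω) := Ring.toSub

section Operators

variable {Ω : TopologicalSpace.Opens (ℝ × ℝ)}

theorem opFun_apply_coeff (a : SmoothFn Ω) (s : SymbolSeries Ω) (i : ℤ) :
    (opFun a s).coeff i = a * s.coeff i := rfl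

theorem coeffDeriv_apply_coeff (d : Derivation ℂ (SmoothFn Ω) (SmoothFn Ω)) (s : SymbolSeries Ω)
    (i : ℤ) : (coeffDeriv d s).coeff i = d (s.coeff i) := rfl

/-- Multiplication operators, as a ring homomorphism. -/
noncomputable def opFunHom (Ω : TopologicalSpace.Opens (ℝ × ℝ)) : SmoothFn Ω →+* PsiOp Ω where
  toFun := opFun
  map_one' := by
    apply LinearMap.ext; intro s; ext1; funext i
    rw [opFun_apply_coeff, one_mul, Module.End.one_apply]
  map_mul' := fun a b => by
    apply LinearMap.ext; intro s; ext1; funext i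
    rw [Module.End.mul_apply, opFun_apply_coeff, opFun_apply_coeff, opFun_apply_coeff, mul_assoc]
  map_zero' := by
    apply LinearMap.ext; intro s; ext1; funext i
    rw [opFun_apply_coeff, zero_mul, LinearMap.zero_apply, HahnSeries.coeff_zero]
  map_add' := fun a b => by
    apply LinearMap.ext; intro s; ext1; funext i
    rw [LinearMap.add_apply, HahnSeries.coeff_add, opFun_apply_coeff, opFun_apply_coeff,
      opFun_apply_coeff, add_mul]

theorem coeffDeriv_mul_opFun (d : Derivation ℂ (SmoothFn Ω) (SmoothFn Ω)) (a : SmoothFn Ω) :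
    coeffDeriv d * opFun a = opFun a * coeffDeriv d + opFun (d a) := by
  apply LinearMap.ext; intro s; ext1; funext i
  rw [LinearMap.add_apply, HahnSeries.coeff_add, Module.End.mul_apply, Module.End.mul_apply,
    coeffDeriv_apply_coeff, opFun_apply_coeff, opFun_apply_coeff, opFun_apply_coeff,
    coeffDeriv_apply_coeff, Derivation.leibniz, smul_eq_mul, smul_eq_mul]
  ring

theorem coeffDeriv_mul_opD (d : Derivation ℂ (SmoothFn Ω) (SmoothFn Ω))
    (hd : ∀ f, d (dx Ω f) = dx Ω (d f)) : coeffDeriv d * opD Ω = opD Ω * coeffDeriv d := by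
  apply LinearMap.ext; intro s; ext1; funext i
  rw [Module.End.mul_apply, Module.End.mul_apply, coeffDeriv_apply_coeff, opD_coeff, opD_coeff,
    coeffDeriv_apply_coeff, coeffDeriv_apply_coeff, map_add, hd]

/-- Whatever commutes with `D` commutes with its two-sided inverse. -/
theorem coeffDeriv_mul_opDInv (d : Derivation ℂ (SmoothFn Ω) (SmoothFn Ω))
    (hd : ∀ f, d (dx Ω f) = dx Ω (d f)) : coeffDeriv d * opDInv Ω = opDInv Ω * coeffDeriv d :=
  calc coeffDeriv d * opDInv Ω = opDInv Ω * (opD Ω * coeffDeriv d) * opDInv Ω := by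
        rw [← mul_assoc, opDInv_mul_opD, one_mul]
    _ = opDInv Ω * coeffDeriv d := by
        rw [← coeffDeriv_mul_opD d hd, mul_assoc, mul_assoc, opD_mul_opDInv, mul_one]

/-- Sandwich `a_x = Da - aD` between two copies of `D⁻¹`. This is the formal version of integration
by parts. -/
theorem opDInv_mul_opFun_dx_mul_opDInv (a : SmoothFn Ω) :
    opDInv Ω * opFun (dx Ω a) * opDInv Ω = opFun a * opDInv Ω - opDInv Ω * opFun a := by
  have h : opFun (dx Ω a) = opD Ω * opFun a - opFun a * opD Ω := by
    rw [opD_mul_opFun, add_sub_cancel_left]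
  rw [h, mul_sub, sub_mul, ← mul_assoc, opDInv_mul_opD, one_mul, mul_assoc (opDInv Ω),
    mul_assoc (opFun a), opD_mul_opDInv, mul_one]

theorem mulOp_eq {m n : ℕ} (A : Matrix (Fin m) (Fin n) (SmoothFn Ω)) :
    mulOp A = A.map (opFunHom Ω) := rfl

theorem mulOp_mul {l m n : ℕ} (A : Matrix (Fin l) (Fin m) (SmoothFn Ω))
    (B : Matrix (Fin m) (Fin n) (SmoothFn Ω)) : mulOp (A * B) = mulOp A * mulOp B := by
  rw [mulOp_eq, mulOp_eq, mulOp_eq, Matrix.map_mul]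

theorem mulOp_add {l m : ℕ} (A B : Matrix (Fin l) (Fin m) (SmoothFn Ω)) :
    mulOp (A + B) = mulOp A + mulOp B :=
  Matrix.map_add _ (map_add (opFunHom Ω)) A B

theorem mulOp_one {l : ℕ} : mulOp (1 : Matrix (Fin l) (Fin l) (SmoothFn Ω)) = 1 :=
  Matrix.map_one _ (map_zero (opFunHom Ω)) (map_one (opFunHom Ω))

theorem scalar_mul_apply {m n : ℕ} (X : PsiOp Ω) (A : Matrix (Fin m) (Fin n) (PsiOp Ω))
    (i : Fin m) (j : Fin n) : (Matrix.scalar (Fin m) X * A) i j = X * A i j :=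
  Matrix.diagonal_mul _ _ _ _

theorem mul_scalar_apply {m n : ℕ} (X : PsiOp Ω) (A : Matrix (Fin m) (Fin n) (PsiOp Ω))
    (i : Fin m) (j : Fin n) : (A * Matrix.scalar (Fin n) X) i j = A i j * X :=
  Matrix.mul_diagonal _ _ _ _

theorem scalar_coeffDeriv_mul_mulOp {m n : ℕ} (d : Derivation ℂ (SmoothFn Ω) (SmoothFn Ω))
    (A : Matrix (Fin m) (Fin n) (SmoothFn Ω)) :
    Matrix.scalar (Fin m) (coeffDeriv d) * mulOp A
      = mulOp A * Matrix.scalar (Fin n) (coeffDeriv d) + mulOp (A.map d) := by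
  ext1 i j
  rw [Matrix.add_apply, scalar_mul_apply, mul_scalar_apply]
  exact coeffDeriv_mul_opFun d (A i j)

theorem scalar_opD_mul_mulOp {m n : ℕ} (A : Matrix (Fin m) (Fin n) (SmoothFn Ω)) :
    Matrix.scalar (Fin m) (opD Ω) * mulOp A
      = mulOp A * Matrix.scalar (Fin n) (opD Ω) + mulOp (A.map (dx Ω)) := by
  ext1 i j
  rw [Matrix.add_apply, scalar_mul_apply, mul_scalar_apply]
  exact opD_mul_opFun (A i j)

theorem scalar_opDInv_mul_mulOp_dx {m n : ℕ} (A : Matrix (Fin m) (Fin n) (SmoothFn Ω)) :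
    Matrix.scalar (Fin m) (opDInv Ω) * mulOp (A.map (dx Ω)) * Matrix.scalar (Fin n) (opDInv Ω)
      = mulOp A * Matrix.scalar (Fin n) (opDInv Ω)
        - Matrix.scalar (Fin m) (opDInv Ω) * mulOp A := by
  ext1 i j
  rw [Matrix.sub_apply, mul_scalar_apply, mul_scalar_apply, scalar_mul_apply, scalar_mul_apply]
  exact opDInv_mul_opFun_dx_mul_opDInv (A i j)

/-- The operator `h D⁻¹ gᵀ`. -/
noncomputable def nonlocalOp {N p : ℕ} (h g : Matrix (Fin N) (Fin p) (SmoothFn Ω)) :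
    Matrix (Fin N) (Fin N) (PsiOp Ω) :=
  mulOp h * Matrix.scalar (Fin p) (opDInv Ω) * mulOp g.transpose

theorem nonlocalOp_add_left {N p : ℕ} (h h' g : Matrix (Fin N) (Fin p) (SmoothFn Ω)) :
    nonlocalOp (h + h') g = nonlocalOp h g + nonlocalOp h' g := by
  rw [nonlocalOp, mulOp_add, Matrix.add_mul, Matrix.add_mul]; rfl

theorem nonlocalOp_add_right {N p : ℕ} (h g g' : Matrix (Fin N) (Fin p) (SmoothFn Ω)) :
    nonlocalOp h (g + g') = nonlocalOp h g + nonlocalOp h g' := by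
  rw [nonlocalOp, Matrix.transpose_add, mulOp_add, Matrix.mul_add]; rfl

/-- For the formal operators any antiderivative `A` of `gᵀh'` serves, since a constant added to `A`
cancels between the two terms. The choice of `A` matters only for the actions. -/
theorem nonlocalOp_mul {N p q : ℕ} (h g : Matrix (Fin N) (Fin p) (SmoothFn Ω))
    (h' g' : Matrix (Fin N) (Fin q) (SmoothFn Ω)) (A : Matrix (Fin p) (Fin q) (SmoothFn Ω))
    (hA : A.map (dx Ω) = g.transpose * h') :
    nonlocalOp h g * nonlocalOp h' g'
      = nonlocalOp (h * A) g' - nonlocalOp h (g' * A.transpose) := by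
  calc nonlocalOp h g * nonlocalOp h' g'
      = mulOp h * (Matrix.scalar (Fin p) (opDInv Ω) * (mulOp g.transpose * mulOp h')
          * Matrix.scalar (Fin q) (opDInv Ω)) * mulOp g'.transpose := by
        simp only [nonlocalOp, Matrix.mul_assoc]
    _ = nonlocalOp (h * A) g' - nonlocalOp h (g' * A.transpose) := by
        rw [← mulOp_mul, ← hA, scalar_opDInv_mul_mulOp_dx, Matrix.mul_sub, Matrix.sub_mul,
          nonlocalOp, nonlocalOp, mulOp_mul, Matrix.transpose_mul, Matrix.transpose_transpose,
          mulOp_mul]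
        simp only [Matrix.mul_assoc]

theorem scalar_opD_mul_nonlocalOp {N p : ℕ} (h g : Matrix (Fin N) (Fin p) (SmoothFn Ω)) :
    Matrix.scalar (Fin N) (opD Ω) * nonlocalOp h g
      = mulOp (h * g.transpose) + nonlocalOp (h.map (dx Ω)) g := by
  have h1 : Matrix.scalar (Fin p) (opD Ω) * Matrix.scalar (Fin p) (opDInv Ω) = 1 := by
    rw [← map_mul, opD_mul_opDInv, map_one]
  rw [nonlocalOp, nonlocalOp, ← Matrix.mul_assoc, ← Matrix.mul_assoc, scalar_opD_mul_mulOp,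
    Matrix.add_mul, Matrix.add_mul, Matrix.mul_assoc (mulOp h), h1, Matrix.mul_one, mulOp_mul]

theorem nonlocalOp_mul_scalar_opD {N p : ℕ} (h g : Matrix (Fin N) (Fin p) (SmoothFn Ω)) :
    nonlocalOp h g * Matrix.scalar (Fin N) (opD Ω)
      = mulOp (h * g.transpose) - nonlocalOp h (g.map (dx Ω)) := by
  have h1 : Matrix.scalar (Fin p) (opDInv Ω) * Matrix.scalar (Fin p) (opD Ω) = 1 := by
    rw [← map_mul, opDInv_mul_opD, map_one]
  have h2 : mulOp g.transpose * Matrix.scalar (Fin N) (opD Ω)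
      = Matrix.scalar (Fin p) (opD Ω) * mulOp g.transpose - mulOp (g.map (dx Ω)).transpose := by
    rw [scalar_opD_mul_mulOp, map_derivation_transpose, add_sub_cancel_right]
  rw [nonlocalOp, nonlocalOp, Matrix.mul_assoc, h2, Matrix.mul_sub, ← Matrix.mul_assoc,
    Matrix.mul_assoc (mulOp h), h1, Matrix.mul_one, mulOp_mul]

theorem scalar_coeffDeriv_mul_nonlocalOp {N p : ℕ} (d : Derivation ℂ (SmoothFn Ω) (SmoothFn Ω))
    (hd : ∀ f, d (dx Ω f) = dx Ω (d f)) (h g : Matrix (Fin N) (Fin p) (SmoothFn Ω)) :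
    Matrix.scalar (Fin N) (coeffDeriv d) * nonlocalOp h g
      = nonlocalOp (h.map d) g + nonlocalOp h (g.map d)
        + nonlocalOp h g * Matrix.scalar (Fin N) (coeffDeriv d) := by
  have h1 : Matrix.scalar (Fin p) (coeffDeriv d) * Matrix.scalar (Fin p) (opDInv Ω)
      = Matrix.scalar (Fin p) (opDInv Ω) * Matrix.scalar (Fin p) (coeffDeriv d) := by
    rw [← map_mul, coeffDeriv_mul_opDInv d hd, map_mul]
  rw [nonlocalOp, nonlocalOp, nonlocalOp, ← Matrix.mul_assoc, ← Matrix.mul_assoc,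
    scalar_coeffDeriv_mul_mulOp, Matrix.add_mul, Matrix.add_mul, Matrix.mul_assoc (mulOp h), h1,
    Matrix.mul_assoc, Matrix.mul_assoc, scalar_coeffDeriv_mul_mulOp, Matrix.mul_add,
    Matrix.mul_add, map_derivation_transpose]
  simp only [Matrix.mul_assoc]
  abel

end Operators

/-! ### Operators together with their actions -/

section OpAct

variable {Ω : TopologicalSpace.Opens (ℝ × ℝ)} (𝓒 : FunctionClass Ω) (N : ℕ)

/-- An operator, an action on matrices over `right` and an action of its transpose on matrices over
`left`. The formal operator does not determine the two actions, whence the bundling. -/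
def OpAct : Type :=
  Matrix (Fin N) (Fin N) (PsiOp Ω) × ((p : ℕ) → AddMonoid.End (RightMat 𝓒 N p)) ×
    ((p : ℕ) → AddMonoid.End (LeftMat 𝓒 N p))ᵐᵒᵖ

noncomputable instance : Ring (OpAct 𝓒 N) :=
  inferInstanceAs (Ring (Matrix (Fin N) (Fin N) (PsiOp Ω) ×
    ((p : ℕ) → AddMonoid.End (RightMat 𝓒 N p)) × ((p : ℕ) → AddMonoid.End (LeftMat 𝓒 N p))ᵐᵒᵖ))

namespace OpAct

variable {𝓒 N} {p p' : ℕ}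

/-- The operator. -/
noncomputable def op (X : OpAct 𝓒 N) : Matrix (Fin N) (Fin N) (PsiOp Ω) := X.1

/-- The action on matrices over `right`. -/
noncomputable def act (X : OpAct 𝓒 N) (f : RightMat 𝓒 N p) : RightMat 𝓒 N p := X.2.1 p f

/-- The action of the transpose on matrices over `left`. -/
noncomputable def actT (X : OpAct 𝓒 N) (f : LeftMat 𝓒 N p) : LeftMat 𝓒 N p := X.2.2.unop p f

/-- An operator with two additive actions. -/
noncomputable def mk (A : Matrix (Fin N) (Fin N) (PsiOp Ω)) (F : (p : ℕ) → RightMat 𝓒 N p →+ RightMat 𝓒 N p)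
    (G : (p : ℕ) → LeftMat 𝓒 N p →+ LeftMat 𝓒 N p) : OpAct 𝓒 N :=
  (A, F, MulOpposite.op G)

theorem ext_op_act {X Y : OpAct 𝓒 N} (h1 : X.op = Y.op)
    (h2 : ∀ (p : ℕ) (f : RightMat 𝓒 N p), X.act f = Y.act f)
    (h3 : ∀ (p : ℕ) (f : LeftMat 𝓒 N p), X.actT f = Y.actT f) : X = Y := by
  refine Prod.ext h1 (Prod.ext ?_ (MulOpposite.unop_injective ?_))
  · funext p; exact AddMonoidHom.ext (h2 p)
  · funext p; exact AddMonoidHom.ext (h3 p)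

variable (X Y : OpAct 𝓒 N) (f f' : RightMat 𝓒 N p) (g g' : LeftMat 𝓒 N p)

@[simp] theorem op_add : (X + Y).op = X.op + Y.op := rfl
@[simp] theorem op_mul : (X * Y).op = X.op * Y.op := rfl
@[simp] theorem op_one : (1 : OpAct 𝓒 N).op = 1 := rfl
@[simp] theorem op_zero : (0 : OpAct 𝓒 N).op = 0 := rfl
@[simp] theorem act_add : (X + Y).act f = X.act f + Y.act f := rfl
@[simp] theorem act_sub : (X - Y).act f = X.act f - Y.act f := rfl
@[simp] theorem act_neg : (-X).act f = -X.act f := rfl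
@[simp] theorem act_mul : (X * Y).act f = X.act (Y.act f) := rfl
@[simp] theorem act_one : (1 : OpAct 𝓒 N).act f = f := rfl
@[simp] theorem act_zero : (0 : OpAct 𝓒 N).act f = 0 := rfl
@[simp] theorem actT_add : (X + Y).actT g = X.actT g + Y.actT g := rfl
@[simp] theorem actT_sub : (X - Y).actT g = X.actT g - Y.actT g := rfl
@[simp] theorem actT_neg : (-X).actT g = -X.actT g := rfl
@[simp] theorem actT_mul : (X * Y).actT g = Y.actT (X.actT g) := rfl
@[simp] theorem actT_one : (1 : OpAct 𝓒 N).actT g = g := rfl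
@[simp] theorem actT_zero : (0 : OpAct 𝓒 N).actT g = 0 := rfl

theorem act_map_add : X.act (f + f') = X.act f + X.act f' := map_add (X.2.1 p) f f'
theorem act_map_neg : X.act (-f) = -X.act f := map_neg (X.2.1 p) f
theorem actT_map_add : X.actT (g + g') = X.actT g + X.actT g' := map_add (X.2.2.unop p) g g'
theorem actT_map_neg : X.actT (-g) = -X.actT g := map_neg (X.2.2.unop p) g

/-- `D`. -/
noncomputable def der : OpAct 𝓒 N :=
  mk (Matrix.scalar (Fin N) (opD Ω)) (fun _ => dxR) (fun p => -(dxL : LeftMat 𝓒 N p →+ LeftMat 𝓒 N p))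

/-- `α ∂/∂t`. -/
noncomputable def evol (α : ℂ) : OpAct 𝓒 N :=
  mk (Matrix.scalar (Fin N) (coeffDeriv (α • dt Ω))) (fun _ => dtR α) (fun p => -(dtL α : LeftMat 𝓒 N p →+ LeftMat 𝓒 N p))

/-- Multiplication by a matrix of coefficients. -/
noncomputable def mul (u : CoeffMat 𝓒 N N) : OpAct 𝓒 N :=
  mk (mulOp (rawMat u)) (fun _ => AddMonoidHom.mk' (lmul u) (lmul_add u))
    (fun _ => AddMonoidHom.mk' (lmul u.transpose) (lmul_add u.transpose))

/-- `h D⁻¹ gᵀ`. -/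
noncomputable def nonloc (h : RightMat 𝓒 N p) (g : LeftMat 𝓒 N p) : OpAct 𝓒 N :=
  mk (nonlocalOp h.1 g.1)
    (fun _ => AddMonoidHom.mk' (fun f => rmul h (pot g f)) fun f f' => by
      rw [pot_add_right, rmul_add])
    (fun _ => AddMonoidHom.mk' (fun f => -rmul g (pot f h).transpose) fun f f' => by
      rw [pot_add_left, Matrix.transpose_add, rmul_add, neg_add])

@[simp] theorem op_der : (der : OpAct 𝓒 N).op = Matrix.scalar (Fin N) (opD Ω) := rfl
@[simp] theorem act_der : (der : OpAct 𝓒 N).act f = dxR f := rfl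
@[simp] theorem actT_der : (der : OpAct 𝓒 N).actT g = -dxL g := rfl
@[simp] theorem op_evol (α : ℂ) :
    (evol α : OpAct 𝓒 N).op = Matrix.scalar (Fin N) (coeffDeriv (α • dt Ω)) := rfl
@[simp] theorem act_evol (α : ℂ) : (evol α : OpAct 𝓒 N).act f = dtR α f := rfl
@[simp] theorem actT_evol (α : ℂ) : (evol α : OpAct 𝓒 N).actT g = -dtL α g := rfl
@[simp] theorem op_coeff (u : CoeffMat 𝓒 N N) : (mul u).op = mulOp (rawMat u) := rfl
@[simp] theorem act_coeff (u : CoeffMat 𝓒 N N) : (mul u).act f = lmul u f := rfl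
@[simp] theorem actT_coeff (u : CoeffMat 𝓒 N N) : (mul u).actT g = lmul u.transpose g := rfl
@[simp] theorem op_nonloc (h : RightMat 𝓒 N p) (g : LeftMat 𝓒 N p) :
    (nonloc h g).op = nonlocalOp h.1 g.1 := rfl
@[simp] theorem act_nonloc (h : RightMat 𝓒 N p') (g : LeftMat 𝓒 N p') :
    (nonloc h g).act f = rmul h (pot g f) := rfl
@[simp] theorem actT_nonloc (h : RightMat 𝓒 N p') (g' : LeftMat 𝓒 N p') :
    (nonloc h g').actT g = -rmul g' (pot g h).transpose := rfl

/-! ### Product rules in the ring of operators with actions -/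

theorem nonloc_add_left (h h' : RightMat 𝓒 N p) (g : LeftMat 𝓒 N p) :
    nonloc (h + h') g = nonloc h g + nonloc h' g := by
  refine ext_op_act (nonlocalOp_add_left _ _ _) (fun _ f => add_rmul _ _ _) fun _ f => ?_
  simp only [actT_add, actT_nonloc, pot_add_right, Matrix.transpose_add, rmul_add, neg_add]

theorem nonloc_add_right (h : RightMat 𝓒 N p) (g g' : LeftMat 𝓒 N p) :
    nonloc h (g + g') = nonloc h g + nonloc h g' := by
  refine ext_op_act (nonlocalOp_add_right _ _ _) (fun _ f => ?_) fun _ f => ?_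
  · simp only [act_add, act_nonloc, pot_add_left, rmul_add]
  · simp only [actT_add, actT_nonloc, add_rmul, neg_add]

/-- `h D⁻¹ gᵀ`, as a biadditive map. -/
noncomputable def nonlocHom (p : ℕ) : RightMat 𝓒 N p →+ LeftMat 𝓒 N p →+ OpAct 𝓒 N :=
  AddMonoidHom.mk' (fun h => AddMonoidHom.mk' (nonloc h) (nonloc_add_right h)) fun h h' =>
    AddMonoidHom.ext (nonloc_add_left h h')

theorem nonloc_neg_left (h : RightMat 𝓒 N p) (g : LeftMat 𝓒 N p) :
    nonloc (-h) g = -nonloc h g :=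
  DFunLike.congr_fun (map_neg (nonlocHom p) h) g

theorem nonloc_neg_right (h : RightMat 𝓒 N p) (g : LeftMat 𝓒 N p) :
    nonloc h (-g) = -nonloc h g :=
  map_neg (nonlocHom p h) g

theorem nonloc_sub_left (h h' : RightMat 𝓒 N p) (g : LeftMat 𝓒 N p) :
    nonloc (h - h') g = nonloc h g - nonloc h' g :=
  DFunLike.congr_fun (map_sub (nonlocHom p) h h') g

theorem nonloc_sub_right (h : RightMat 𝓒 N p) (g g' : LeftMat 𝓒 N p) :
    nonloc h (g - g') = nonloc h g - nonloc h g' :=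
  map_sub (nonlocHom p h) g g'

theorem nonloc_zero_left (g : LeftMat 𝓒 N p) : nonloc (0 : RightMat 𝓒 N p) g = 0 :=
  DFunLike.congr_fun (map_zero (nonlocHom p)) g

theorem nonloc_zero_right (h : RightMat 𝓒 N p) : nonloc h 0 = 0 :=
  map_zero (nonlocHom p h)

/-- Constants pass through `D⁻¹`, formally by its `ℂ`-linearity and in the actions because
potentials are linear over constant matrices. -/
theorem nonloc_rmul_const (h : RightMat 𝓒 N p) (g : LeftMat 𝓒 N p')
    (S : Matrix (Fin p) (Fin p') ℂ) :
    nonloc (rmul h (constCoeff 𝓒 S)) g = nonloc h (rmul g (constCoeff 𝓒 S).transpose) := by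
  refine ext_op_act ?_ (fun _ f => ?_) fun _ f => ?_
  · have hc : Matrix.scalar (Fin p) (opDInv Ω) * mulOp (constMat Ω S)
        = mulOp (constMat Ω S) * Matrix.scalar (Fin p') (opDInv Ω) := by
      ext1 i j
      rw [scalar_mul_apply, mul_scalar_apply]
      apply LinearMap.ext; intro s
      change opDInv Ω (opFun (algebraMap ℂ _ (S i j)) s)
        = opFun (algebraMap ℂ _ (S i j)) (opDInv Ω s)
      have h1 : ∀ s : SymbolSeries Ω, opFun (algebraMap ℂ _ (S i j)) s = S i j • s := by
        intro s; ext1; funext k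
        rw [opFun_apply_coeff, HahnSeries.coeff_smul, Algebra.smul_def]
      rw [h1, h1, map_smul]
    simp only [op_nonloc, nonlocalOp, coe_rmul, rawMat_transpose, rawMat_constCoeff, mulOp_mul,
      Matrix.transpose_mul, Matrix.transpose_transpose]
    simp only [Matrix.mul_assoc]
    rw [← Matrix.mul_assoc (mulOp (constMat Ω S)), ← hc, Matrix.mul_assoc]
  · rw [act_nonloc, act_nonloc, ← constCoeff_transpose, pot_rmul_const_left, rmul_rmul]
    rfl
  · rw [actT_nonloc, actT_nonloc, pot_rmul_const, Matrix.transpose_mul, rmul_rmul]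

/-- Integration by parts in all three components at once. The actions both reduce to `pot_mul_pot`,
which is where the specific antiderivative `pot g h'` is needed. -/
theorem nonloc_mul_nonloc (h : RightMat 𝓒 N p) (g : LeftMat 𝓒 N p) (h' : RightMat 𝓒 N p')
    (g' : LeftMat 𝓒 N p') :
    nonloc h g * nonloc h' g'
      = nonloc (rmul h (pot g h')) g' - nonloc h (rmul g' (pot g h').transpose) := by
  refine ext_op_act (nonlocalOp_mul _ _ _ _ _ (pot_map_dx g h')) (fun _ f => ?_) fun _ f => ?_
  · rw [act_mul, act_nonloc, act_nonloc, act_sub, act_nonloc, act_nonloc, rmul_rmul, ← rmul_sub,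
      pot_mul_pot, add_sub_cancel_right]
  · rw [actT_mul, actT_nonloc, actT_nonloc, actT_sub, actT_nonloc, actT_nonloc, rmul_rmul,
      pot_neg_left, Matrix.transpose_neg, rmul_neg, neg_neg, sub_neg_eq_add, neg_add_eq_sub,
      ← rmul_sub, ← Matrix.transpose_mul, pot_mul_pot f h g h', Matrix.transpose_add,
      add_sub_cancel_left]

theorem mul_mul_nonloc (u : CoeffMat 𝓒 N N) (h : RightMat 𝓒 N p) (g : LeftMat 𝓒 N p) :
    mul u * nonloc h g = nonloc (lmul u h) g := by
  refine ext_op_act ?_ (fun _ f => ?_) fun _ f => ?_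
  · simp only [op_mul, op_coeff, op_nonloc, nonlocalOp, coe_lmul, mulOp_mul, Matrix.mul_assoc]
  · rw [act_mul, act_nonloc, act_coeff, act_nonloc, lmul_rmul]
  · rw [actT_mul, actT_nonloc, actT_coeff, actT_nonloc, pot_lmul]

theorem nonloc_mul_mul (u : CoeffMat 𝓒 N N) (h : RightMat 𝓒 N p) (g : LeftMat 𝓒 N p) :
    nonloc h g * mul u = nonloc h (lmul u.transpose g) := by
  refine ext_op_act ?_ (fun _ f => ?_) fun _ f => ?_
  · simp only [op_mul, op_coeff, op_nonloc, nonlocalOp, coe_lmul, Matrix.transpose_mul,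
      rawMat_transpose, Matrix.transpose_transpose, mulOp_mul, Matrix.mul_assoc]
  · rw [act_mul, act_nonloc, act_coeff, act_nonloc, pot_lmul]
  · rw [actT_mul, actT_nonloc, actT_coeff, actT_nonloc, lmul_neg, lmul_rmul]

theorem der_mul_nonloc (h : RightMat 𝓒 N p) (g : LeftMat 𝓒 N p) :
    der * nonloc h g = mul (outer h g) + nonloc (dxR h) g := by
  refine ext_op_act (scalar_opD_mul_nonlocalOp _ _) (fun _ f => ?_) fun _ f => ?_
  · rw [act_mul, act_nonloc, act_der, dxR_rmul, dxC_pot, act_add, act_coeff, act_nonloc,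
      rmul_pairing, add_comm]
  · rw [actT_mul, actT_nonloc, actT_der, actT_add, actT_coeff, actT_nonloc, pot_neg_left,
      Matrix.transpose_neg, rmul_neg, neg_neg, ← rmul_pairing_transpose, ← pot_dx,
      Matrix.transpose_add, rmul_add, add_neg_cancel_right]

theorem nonloc_mul_der (h : RightMat 𝓒 N p) (g : LeftMat 𝓒 N p) :
    nonloc h g * der = mul (outer h g) - nonloc h (dxL g) := by
  refine ext_op_act (nonlocalOp_mul_scalar_opD _ _) (fun _ f => ?_) fun _ f => ?_
  · rw [act_mul, act_nonloc, act_der, act_sub, act_coeff, act_nonloc, ← rmul_pairing, ← pot_dx,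
      rmul_add, add_sub_cancel_left]
  · rw [actT_mul, actT_nonloc, actT_der, actT_sub, actT_coeff, actT_nonloc, map_neg, neg_neg,
      dxL_rmul, ← rmul_pairing_transpose, ← dxC_pot, sub_neg_eq_add, add_comm]
    rfl

theorem smul_dt_dx (α : ℂ) (f : SmoothFn Ω) : (α • dt Ω) (dx Ω f) = dx Ω ((α • dt Ω) f) := by
  rw [Derivation.smul_apply, Derivation.smul_apply, Derivation.map_smul, dx_dt_comm]

/-- The Leibniz rule for `∂/∂t` on both factors, as `∂/∂t` commutes with `D⁻¹`; for the actions this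
commutation is `pot_dt`. -/
theorem evol_mul_nonloc (α : ℂ) (h : RightMat 𝓒 N p) (g : LeftMat 𝓒 N p) :
    evol α * nonloc h g
      = nonloc (dtR α h) g + nonloc h (dtL α g) + nonloc h g * evol α := by
  refine ext_op_act (scalar_coeffDeriv_mul_nonlocalOp _ (smul_dt_dx α) _ _) (fun _ f => ?_)
    fun _ f => ?_
  · rw [act_mul, act_nonloc, act_evol, act_add, act_add, act_mul, act_nonloc, act_nonloc,
      act_nonloc, act_evol, dtR_rmul, ← pot_dt, rmul_add, add_assoc]
  · have h1 : (dtC α (pot f h)).transpose = (pot (dtL α f) h).transpose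
        + (pot f (dtR α h)).transpose := by rw [← pot_dt, Matrix.transpose_add]
    have h2 : dtC α (pot f h).transpose = (dtC α (pot f h)).transpose := rfl
    rw [actT_mul, actT_nonloc, actT_evol, actT_add, actT_add, actT_mul, actT_nonloc, actT_nonloc,
      actT_nonloc, actT_evol, map_neg, neg_neg, dtL_rmul, h2, h1, pot_neg_left,
      Matrix.transpose_neg, rmul_neg, neg_neg, rmul_add]
    abel

theorem der_mul_mul (u : CoeffMat 𝓒 N N) : der * mul u = mul u * der + mul (dxC u) := by
  refine ext_op_act (scalar_opD_mul_mulOp _) (fun _ f => dxR_lmul u f) fun _ f => ?_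
  have h : dxC u.transpose = (dxC u).transpose := rfl
  rw [actT_mul, actT_add, actT_mul, actT_coeff, actT_coeff, actT_der, actT_der, dxL_lmul, h]
  rw [lmul_neg, neg_add, actT_coeff, neg_add_cancel_right]

theorem mul_add_coeff (u v : CoeffMat 𝓒 N N) : mul (u + v) = mul u + mul v :=
  ext_op_act (mulOp_add _ _) (fun _ f => add_lmul u v f) fun _ f => by
    rw [actT_add, actT_coeff, actT_coeff, actT_coeff, Matrix.transpose_add, add_lmul]

theorem mul_mul_coeff (u v : CoeffMat 𝓒 N N) : mul (u * v) = mul u * mul v :=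
  ext_op_act (by rw [op_mul, op_coeff, op_coeff, op_coeff, rawMat_mul, mulOp_mul])
    (fun _ f => (lmul_lmul u v f).symm) fun _ f => by
      rw [actT_mul, actT_coeff, actT_coeff, actT_coeff, Matrix.transpose_mul, lmul_lmul]

/-- Multiplication operators, as an additive homomorphism. -/
noncomputable def mulHom : CoeffMat 𝓒 N N →+ OpAct 𝓒 N := AddMonoidHom.mk' mul mul_add_coeff

theorem mul_zero_coeff : mul (0 : CoeffMat 𝓒 N N) = 0 := map_zero mulHom

theorem mul_one_coeff : mul (1 : CoeffMat 𝓒 N N) = 1 :=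
  ext_op_act (by rw [op_coeff, op_one, rawMat_one, mulOp_one])
    (fun _ f => Subtype.ext (by simp)) fun _ f => Subtype.ext (by simp)

theorem mul_neg_coeff (u : CoeffMat 𝓒 N N) : mul (-u) = -mul u := map_neg mulHom u

end OpAct

end OpAct

/-- A noncommutative version of `a^(l+1) - t^(l+1) = (a - t) ∑ a^s t^(l-s)`: with `D` inverse to
`C`, each summand is a difference of consecutive values of `s ↦ C A^s D T^(l+1-s) C`. It is used
with `A = Λ` and `T = Λ̃ᵀ`. -/
theorem sum_telescope {R : Type*} [Ring R] {C D : R} (h : C * D = 1) (h' : D * C = 1) (A T : R)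
    (l : ℕ) : ∑ s ∈ Finset.range (l + 1), C * A ^ s * D * (C * A - T * C) * (D * T ^ (l - s) * C)
      = C * A ^ (l + 1) - T ^ (l + 1) * C := by
  have e : ∀ s ∈ Finset.range (l + 1),
      C * A ^ s * D * (C * A - T * C) * (D * T ^ (l - s) * C)
        = C * A ^ (s + 1) * D * T ^ (l + 1 - (s + 1)) * C
          - C * A ^ s * D * T ^ (l + 1 - s) * C := by
    intro s hs
    -- The truncated subtraction is harmless because `s ≤ l`.
    have hs' : l + 1 - s = l - s + 1 := by have := Finset.mem_range.1 hs; omega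
    rw [hs', Nat.add_sub_add_right, pow_succ A s, pow_succ' T (l - s)]
    calc _ = C * A ^ s * (D * C) * A * D * T ^ (l - s) * C
          - C * A ^ s * D * T * (C * D) * T ^ (l - s) * C := by noncomm_ring
      _ = _ := by rw [h, h']; noncomm_ring
  rw [Finset.sum_congr rfl e,
    Finset.sum_range_sub (fun s => C * A ^ s * D * T ^ (l + 1 - s) * C)]
  simp only [Nat.sub_self, pow_zero, mul_one, Nat.sub_zero, mul_assoc, h']
  rw [← mul_assoc C D, h, one_mul]

namespace OpAct

variable {Ω : TopologicalSpace.Opens (ℝ × ℝ)} {𝓒 : FunctionClass Ω} {N p p' : ℕ}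

/-! ### Differential operators -/

variable (𝓒 N) in
/-- Differential operators in `D` of order less than `k`. -/
noncomputable def localOps (k : ℕ) : AddSubgroup (OpAct 𝓒 N) :=
  AddSubgroup.closure {X | ∃ i < k, ∃ u : CoeffMat 𝓒 N N, X = mul u * der ^ i}

theorem mul_der_pow_mem {i k : ℕ} (h : i < k) (u : CoeffMat 𝓒 N N) :
    mul u * der ^ i ∈ localOps 𝓒 N k :=
  AddSubgroup.subset_closure ⟨i, h, u, rfl⟩

@[elab_as_elim]
theorem localOps_induction {k : ℕ} {P : OpAct 𝓒 N → Prop} {X : OpAct 𝓒 N}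
    (hX : X ∈ localOps 𝓒 N k) (gen : ∀ i < k, ∀ u, P (mul u * der ^ i)) (zero : P 0)
    (add : ∀ X Y, P X → P Y → P (X + Y)) (neg : ∀ X, P X → P (-X)) : P X := by
  refine AddSubgroup.closure_induction ?_ zero (fun X Y _ _ => add X Y) (fun X _ => neg X) hX
  rintro _ ⟨i, hi, u, rfl⟩
  exact gen i hi u

theorem localOps_mono {k k' : ℕ} (h : k ≤ k') : localOps 𝓒 N k ≤ localOps 𝓒 N k' :=
  AddSubgroup.closure_mono fun _ ⟨i, hi, u, hu⟩ => ⟨i, hi.trans_le h, u, hu⟩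

theorem mul_mem_localOps {k : ℕ} (u : CoeffMat 𝓒 N N) : mul u ∈ localOps 𝓒 N (k + 1) := by
  simpa using mul_der_pow_mem k.succ_pos u

theorem mul_mul_mem_localOps {k : ℕ} (v : CoeffMat 𝓒 N N) {X : OpAct 𝓒 N}
    (hX : X ∈ localOps 𝓒 N k) : mul v * X ∈ localOps 𝓒 N k := by
  refine localOps_induction hX (fun i hi u => ?_) ?_ (fun X Y hX hY => ?_) (fun X hX => ?_)
  · rw [← mul_assoc, ← mul_mul_coeff]
    exact mul_der_pow_mem hi _
  · rw [mul_zero]; exact zero_mem _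
  · rw [mul_add]; exact add_mem hX hY
  · rw [mul_neg]; exact neg_mem hX

theorem mul_der_mem_localOps {k : ℕ} {X : OpAct 𝓒 N} (hX : X ∈ localOps 𝓒 N k) :
    X * der ∈ localOps 𝓒 N (k + 1) := by
  refine localOps_induction hX (fun i hi u => ?_) ?_ (fun X Y hX hY => ?_) (fun X hX => ?_)
  · rw [mul_assoc, ← pow_succ]
    exact mul_der_pow_mem (Nat.succ_lt_succ hi) _
  · rw [zero_mul]; exact zero_mem _
  · rw [add_mul]; exact add_mem hX hY
  · rw [neg_mul]; exact neg_mem hX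

theorem der_mul_mem_localOps {k : ℕ} {X : OpAct 𝓒 N} (hX : X ∈ localOps 𝓒 N k) :
    der * X ∈ localOps 𝓒 N (k + 1) := by
  refine localOps_induction hX (fun i hi u => ?_) ?_ (fun X Y hX hY => ?_) (fun X hX => ?_)
  · rw [← mul_assoc, der_mul_mul, add_mul, mul_assoc, ← pow_succ']
    exact add_mem (mul_der_pow_mem (Nat.succ_lt_succ hi) _) (mul_der_pow_mem (by omega) _)
  · rw [mul_zero]; exact zero_mem _
  · rw [mul_add]; exact add_mem hX hY
  · rw [mul_neg]; exact neg_mem hX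

/-- Each `D` moved past `h` either differentiates it or cancels `D⁻¹`. The remainder is a
differential operator of order below `i`; this loss of one order later preserves the leading
coefficient. -/
theorem der_pow_mul_nonloc (i : ℕ) (h : RightMat 𝓒 N p) (g : LeftMat 𝓒 N p) :
    der ^ i * nonloc h g - nonloc ((der ^ i).act h) g ∈ localOps 𝓒 N i := by
  induction i with
  | zero => simp
  | succ i ih =>
    have e : der ^ (i + 1) * nonloc h g - nonloc ((der ^ (i + 1)).act h) g
        = der * (der ^ i * nonloc h g - nonloc ((der ^ i).act h) g)
          + mul (outer ((der ^ i).act h) g) := by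
      rw [pow_succ', act_mul, act_der, mul_sub, der_mul_nonloc, mul_assoc]
      abel
    rw [e]
    exact add_mem (der_mul_mem_localOps ih) (mul_mem_localOps _)

theorem nonloc_mul_der_pow (i : ℕ) (h : RightMat 𝓒 N p) (g : LeftMat 𝓒 N p) :
    nonloc h g * der ^ i - nonloc h ((der ^ i).actT g) ∈ localOps 𝓒 N i := by
  induction i with
  | zero => simp
  | succ i ih =>
    have e : nonloc h g * der ^ (i + 1) - nonloc h ((der ^ (i + 1)).actT g)
        = (nonloc h g * der ^ i - nonloc h ((der ^ i).actT g)) * der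
          + mul (outer h ((der ^ i).actT g)) := by
      rw [pow_succ, actT_mul, actT_der, sub_mul, nonloc_mul_der, mul_assoc, nonloc_neg_right]
      abel
    rw [e]
    exact add_mem (mul_der_mem_localOps ih) (mul_mem_localOps _)

/-- The nonlocal part of a product with a differential operator is read off from its action on `h`.
The mirror statement below uses the transposed action on `g`. -/
theorem local_mul_nonloc {k : ℕ} {X : OpAct 𝓒 N} (hX : X ∈ localOps 𝓒 N (k + 1))
    (h : RightMat 𝓒 N p) (g : LeftMat 𝓒 N p) :
    X * nonloc h g - nonloc (X.act h) g ∈ localOps 𝓒 N k := by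
  refine localOps_induction hX (fun i hi u => ?_) ?_ (fun X Y hX hY => ?_) (fun X hX => ?_)
  · have e : mul u * der ^ i * nonloc h g - nonloc ((mul u * der ^ i).act h) g
        = mul u * (der ^ i * nonloc h g - nonloc ((der ^ i).act h) g) := by
      rw [mul_sub, mul_mul_nonloc, mul_assoc, act_mul, act_coeff]
    rw [e]
    exact localOps_mono (Nat.lt_succ_iff.1 hi) (mul_mul_mem_localOps u (der_pow_mul_nonloc i h g))
  · rw [zero_mul, act_zero, nonloc_zero_left, sub_zero]; exact zero_mem _
  · rw [add_mul, act_add, nonloc_add_left, add_sub_add_comm]; exact add_mem hX hY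
  · rw [neg_mul, act_neg, nonloc_neg_left, ← neg_sub']; exact neg_mem hX

theorem nonloc_mul_local {k : ℕ} {X : OpAct 𝓒 N} (hX : X ∈ localOps 𝓒 N (k + 1))
    (h : RightMat 𝓒 N p) (g : LeftMat 𝓒 N p) :
    nonloc h g * X - nonloc h (X.actT g) ∈ localOps 𝓒 N k := by
  refine localOps_induction hX (fun i hi u => ?_) ?_ (fun X Y hX hY => ?_) (fun X hX => ?_)
  · have e : nonloc h g * (mul u * der ^ i) - nonloc h ((mul u * der ^ i).actT g)
        = nonloc h (lmul u.transpose g) * der ^ i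
          - nonloc h ((der ^ i).actT (lmul u.transpose g)) := by
      rw [← mul_assoc, nonloc_mul_mul, actT_mul, actT_coeff]
    rw [e]
    exact localOps_mono (Nat.lt_succ_iff.1 hi) (nonloc_mul_der_pow i h _)
  · rw [mul_zero, actT_zero, nonloc_zero_right, sub_zero]; exact zero_mem _
  · rw [mul_add, actT_add, nonloc_add_right, add_sub_add_comm]; exact add_mem hX hY
  · rw [mul_neg, actT_neg, nonloc_neg_right, ← neg_sub']; exact neg_mem hX

/-- Returns from the span, convenient for inductions, to the normal form with one coefficient per
power of `D`. -/
theorem exists_coeffs {k : ℕ} {X : OpAct 𝓒 N} (hX : X ∈ localOps 𝓒 N k) :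
    ∃ u : ℕ → CoeffMat 𝓒 N N, X = ∑ i ∈ Finset.range k, mul (u i) * der ^ i := by
  refine localOps_induction hX (fun i hi u => ⟨Pi.single i u, ?_⟩) ⟨0, ?_⟩ ?_ ?_
  · rw [Finset.sum_eq_single i, Pi.single_eq_same]
    · intro j _ hj
      rw [Pi.single_eq_of_ne hj, mul_zero_coeff, zero_mul]
    · intro h; exact absurd (Finset.mem_range.2 hi) h
  · exact (Finset.sum_eq_zero fun i _ => by rw [Pi.zero_apply, mul_zero_coeff, zero_mul]).symm
  · rintro X Y ⟨u, rfl⟩ ⟨v, rfl⟩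
    refine ⟨u + v, ?_⟩
    rw [← Finset.sum_add_distrib]
    exact Finset.sum_congr rfl fun i _ => by rw [Pi.add_apply, mul_add_coeff, add_mul]
  · rintro X ⟨u, rfl⟩
    refine ⟨-u, ?_⟩
    rw [← Finset.sum_neg_distrib]
    exact Finset.sum_congr rfl fun i _ => by rw [Pi.neg_apply, mul_neg_coeff, neg_mul]

/-- The differential operator `J D^k + ∑_{i < k} u_i D^i`. -/
noncomputable def diffOp (k : ℕ) (J : Matrix (Fin N) (Fin N) ℂ) (u : ℕ → CoeffMat 𝓒 N N) :
    OpAct 𝓒 N :=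
  mul (constCoeff 𝓒 J) * der ^ k + ∑ i ∈ Finset.range k, mul (u i) * der ^ i

theorem diffOp_mem_localOps (k : ℕ) (J : Matrix (Fin N) (Fin N) ℂ) (u : ℕ → CoeffMat 𝓒 N N) :
    diffOp k J u ∈ localOps 𝓒 N (k + 1) :=
  add_mem (mul_der_pow_mem k.lt_succ_self _) (sum_mem fun _ hi =>
    mul_der_pow_mem (Nat.lt_succ_of_lt (Finset.mem_range.1 hi)) _)

/-! ### Compatibility with constant matrices -/

variable (𝓒 N) in
/-- The operators whose actions commute with multiplication by constant matrices from the right. -/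
noncomputable def constLinear : Subring (OpAct 𝓒 N) where
  carrier := {X | (∀ (p p' : ℕ) (f : RightMat 𝓒 N p) (S : Matrix (Fin p) (Fin p') ℂ),
      X.act (rmul f (constCoeff 𝓒 S)) = rmul (X.act f) (constCoeff 𝓒 S)) ∧
    ∀ (p p' : ℕ) (f : LeftMat 𝓒 N p) (S : Matrix (Fin p) (Fin p') ℂ),
      X.actT (rmul f (constCoeff 𝓒 S)) = rmul (X.actT f) (constCoeff 𝓒 S)}
  mul_mem' := fun {X Y} hX hY =>
    ⟨fun _ _ f S => by rw [act_mul, act_mul, hY.1, hX.1],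
      fun _ _ f S => by rw [actT_mul, actT_mul, hX.2, hY.2]⟩
  one_mem' := ⟨fun _ _ _ _ => rfl, fun _ _ _ _ => rfl⟩
  add_mem' := fun {X Y} hX hY =>
    ⟨fun _ _ f S => by rw [act_add, act_add, hX.1, hY.1, add_rmul],
      fun _ _ f S => by rw [actT_add, actT_add, hX.2, hY.2, add_rmul]⟩
  zero_mem' := ⟨fun _ _ _ _ => Subtype.ext (by simp), fun _ _ _ _ => Subtype.ext (by simp)⟩
  neg_mem' := fun {X} hX =>
    ⟨fun _ _ f S => by rw [act_neg, act_neg, hX.1, neg_rmul],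
      fun _ _ f S => by rw [actT_neg, actT_neg, hX.2, neg_rmul]⟩

theorem act_rmul_const {X : OpAct 𝓒 N} (hX : X ∈ constLinear 𝓒 N) (f : RightMat 𝓒 N p)
    (S : Matrix (Fin p) (Fin p') ℂ) :
    X.act (rmul f (constCoeff 𝓒 S)) = rmul (X.act f) (constCoeff 𝓒 S) := by
  have h := hX
  exact h.1 _ _ f S

theorem actT_rmul_const {X : OpAct 𝓒 N} (hX : X ∈ constLinear 𝓒 N) (f : LeftMat 𝓒 N p)
    (S : Matrix (Fin p) (Fin p') ℂ) :
    X.actT (rmul f (constCoeff 𝓒 S)) = rmul (X.actT f) (constCoeff 𝓒 S) := by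
  have h := hX
  exact h.2 _ _ f S

theorem nonloc_mem_constLinear (h : RightMat 𝓒 N p) (g : LeftMat 𝓒 N p) :
    nonloc h g ∈ constLinear 𝓒 N :=
  ⟨fun _ _ f S => by rw [act_nonloc, act_nonloc, pot_rmul_const, rmul_rmul],
    fun _ _ f S => by
      rw [actT_nonloc, actT_nonloc, pot_rmul_const_left, Matrix.transpose_mul,
        Matrix.transpose_transpose, neg_rmul, rmul_rmul]⟩

theorem mul_mem_constLinear (u : CoeffMat 𝓒 N N) : mul u ∈ constLinear 𝓒 N :=
  ⟨fun _ _ f S => by rw [act_coeff, act_coeff, lmul_rmul],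
    fun _ _ f S => by rw [actT_coeff, actT_coeff, lmul_rmul]⟩

theorem mapDer_rmul_const {S : Submodule 𝓒.coeff (SmoothFn Ω)}
    (d : Derivation ℂ (SmoothFn Ω) (SmoothFn Ω)) (hd : ∀ f ∈ S, d f ∈ S) (f : entries S N p)
    (A : Matrix (Fin p) (Fin p') ℂ) :
    mapDer d hd (rmul f (constCoeff 𝓒 A)) = rmul (mapDer d hd f) (constCoeff 𝓒 A) :=
  Subtype.ext (by
    rw [coe_mapDer, coe_rmul, coe_rmul, map_derivation_mul, rawMat_constCoeff,
      constMat_map_derivation, Matrix.mul_zero, add_zero, coe_mapDer])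

theorem der_mem_constLinear : der ∈ constLinear 𝓒 N :=
  ⟨fun _ _ f S => mapDer_rmul_const _ 𝓒.dx_right f S,
    fun _ _ f S => by
      rw [actT_der, actT_der, neg_rmul]
      exact congrArg Neg.neg (mapDer_rmul_const _ 𝓒.dx_left f S)⟩

theorem evol_mem_constLinear (α : ℂ) : evol α ∈ constLinear 𝓒 N :=
  ⟨fun _ _ f S => mapDer_rmul_const _ (smul_derivation_mem 𝓒.dt_right α) f S,
    fun _ _ f S => by
      rw [actT_evol, actT_evol, neg_rmul]
      exact congrArg Neg.neg (mapDer_rmul_const _ (smul_derivation_mem 𝓒.dt_left α) f S)⟩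

theorem diffOp_mem_constLinear (k : ℕ) (J : Matrix (Fin N) (Fin N) ℂ)
    (u : ℕ → CoeffMat 𝓒 N N) : diffOp k J u ∈ constLinear 𝓒 N :=
  add_mem (mul_mem (mul_mem_constLinear _) (pow_mem der_mem_constLinear _)) (sum_mem fun _ _ =>
    mul_mem (mul_mem_constLinear _) (pow_mem der_mem_constLinear _))

/-- Elements of `OpAct` act only additively in general, so membership in `constLinear` is what lets
the matrix eigenvalue be pulled out at each iteration. -/
theorem pow_act_of_act {X : OpAct 𝓒 N} (hX : X ∈ constLinear 𝓒 N) {f : RightMat 𝓒 N p}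
    {A : Matrix (Fin p) (Fin p) ℂ} (h : X.act f = rmul f (constCoeff 𝓒 A)) (j : ℕ) :
    (X ^ j).act f = rmul f (constCoeff 𝓒 (A ^ j)) := by
  induction j with
  | zero => rw [pow_zero, pow_zero, constCoeff_one, rmul_one, act_one]
  | succ j ih => rw [pow_succ', act_mul, ih, act_rmul_const hX, h, rmul_rmul, ← constCoeff_mul,
      pow_succ']

theorem pow_actT_of_actT {X : OpAct 𝓒 N} (hX : X ∈ constLinear 𝓒 N) {f : LeftMat 𝓒 N p}
    {A : Matrix (Fin p) (Fin p) ℂ} (h : X.actT f = rmul f (constCoeff 𝓒 A)) (j : ℕ) :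
    (X ^ j).actT f = rmul f (constCoeff 𝓒 (A ^ j)) := by
  induction j with
  | zero => rw [pow_zero, pow_zero, constCoeff_one, rmul_one, actT_one]
  | succ j ih => rw [pow_succ, actT_mul, ih, actT_rmul_const hX, h, rmul_rmul, ← constCoeff_mul,
      pow_succ']

/-- The operators `∑_j q[j] S D⁻¹ rᵀ[l-j]`. -/
noncomputable def chainOp (M : OpAct 𝓒 N) (l : ℕ) (q : RightMat 𝓒 N p) (r : LeftMat 𝓒 N p)
    (S : Matrix (Fin p) (Fin p) ℂ) : OpAct 𝓒 N :=
  ∑ j ∈ Finset.range (l + 1),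
    nonloc (rmul ((M ^ j).act q) (constCoeff 𝓒 S)) ((M ^ (l - j)).actT r)

end OpAct

/-! ### The binary Darboux transformation in the algebra of operators with actions -/

/-- The data of a binary Darboux transformation: `Δinv` is the inverse of `C + D⁻¹{ψᵀ φ}`. -/
structure DarbouxData {Ω : TopologicalSpace.Opens (ℝ × ℝ)} (𝓒 : FunctionClass Ω) (N K : ℕ) where
  φ : RightMat 𝓒 N K
  ψ : LeftMat 𝓒 N K
  C : Matrix (Fin K) (Fin K) ℂ
  Cinv : Matrix (Fin K) (Fin K) ℂ
  Δinv : CoeffMat 𝓒 K K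
  C_mul_Cinv : C * Cinv = 1
  Cinv_mul_C : Cinv * C = 1
  Δ_mul_Δinv : (constCoeff 𝓒 C + pot ψ φ) * Δinv = 1
  Δinv_mul_Δ : Δinv * (constCoeff 𝓒 C + pot ψ φ) = 1

namespace DarbouxData

open OpAct

variable {Ω : TopologicalSpace.Opens (ℝ × ℝ)} {𝓒 : FunctionClass Ω} {N K p : ℕ}
  (𝓓 : DarbouxData 𝓒 N K)

/-- `Δ = C + D⁻¹{ψᵀ φ}`. -/
noncomputable def Δ : CoeffMat 𝓒 K K := constCoeff 𝓒 𝓓.C + pot 𝓓.ψ 𝓓.φ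

/-- `Φ = φ Δ⁻¹`. -/
noncomputable def Φ : RightMat 𝓒 N K := rmul 𝓓.φ 𝓓.Δinv

/-- `Ψ = ψ (Δ⁻¹)ᵀ`. -/
noncomputable def Ψ : LeftMat 𝓒 N K := rmul 𝓓.ψ 𝓓.Δinv.transpose

/-- `W = I - Φ D⁻¹ ψᵀ`. -/
noncomputable def W : OpAct 𝓒 N := 1 - nonloc 𝓓.Φ 𝓓.ψ

/-- `V = I + φ D⁻¹ Ψᵀ`, the inverse of `W`. -/
noncomputable def V : OpAct 𝓒 N := 1 + nonloc 𝓓.φ 𝓓.Ψ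

theorem pot_ψ_φ : pot 𝓓.ψ 𝓓.φ = 𝓓.Δ - constCoeff 𝓒 𝓓.C := by
  rw [Δ, add_sub_cancel_left]

theorem rmul_Φ_Δ : rmul 𝓓.Φ 𝓓.Δ = 𝓓.φ := by
  rw [Φ, rmul_rmul, Δ, 𝓓.Δinv_mul_Δ, rmul_one]

theorem rmul_Ψ_Δ : rmul 𝓓.Ψ 𝓓.Δ.transpose = 𝓓.ψ := by
  rw [Ψ, rmul_rmul, ← Matrix.transpose_mul, Δ, 𝓓.Δ_mul_Δinv, Matrix.transpose_one, rmul_one]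

theorem dxC_Δ : dxC 𝓓.Δ = pairing 𝓓.ψ 𝓓.φ := by
  apply rawMat_injective
  rw [Δ, rawMat_dxC, rawMat_add, map_derivation_add, rawMat_constCoeff, constMat_map_derivation,
    zero_add, pot_map_dx, rawMat_pairing]

theorem dtC_Δ (α : ℂ) : dtC α 𝓓.Δ = pot (dtL α 𝓓.ψ) 𝓓.φ + pot 𝓓.ψ (dtR α 𝓓.φ) := by
  rw [pot_dt]
  apply rawMat_injective
  rw [Δ, rawMat_dtC, rawMat_add, map_derivation_add, rawMat_constCoeff, constMat_map_derivation,
    zero_add, rawMat_dtC]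

/-- Integrating the cross term by parts with `D⁻¹{ψᵀφ} = Δ - C`, the `Δ` parts give back `φ D⁻¹ Ψᵀ -
Φ D⁻¹ ψᵀ`, and the `C` parts cancel because `C` is constant. -/
theorem W_mul_V : 𝓓.W * 𝓓.V = 1 := by
  have h : nonloc 𝓓.Φ 𝓓.ψ * nonloc 𝓓.φ 𝓓.Ψ = nonloc 𝓓.φ 𝓓.Ψ - nonloc 𝓓.Φ 𝓓.ψ := by
    rw [nonloc_mul_nonloc, pot_ψ_φ, rmul_sub, Matrix.transpose_sub, rmul_sub, rmul_Φ_Δ, rmul_Ψ_Δ,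
      nonloc_sub_left, nonloc_sub_right, nonloc_rmul_const]
    abel
  rw [W, V, sub_mul, one_mul, mul_add, mul_one, h]
  abel

/-- Differentiating `ΔΔ⁻¹ = 1` gives `(Δ⁻¹)_x = -Δ⁻¹ψᵀφΔ⁻¹ = -ΨᵀΦ`. The integration constant is
`C⁻¹` since `C⁻¹ - Δ⁻¹ = C⁻¹(Δ - C)Δ⁻¹` lies in the ideal `decay`; this uses that `C` is invertible.
-/
theorem pot_Ψ_Φ : pot 𝓓.Ψ 𝓓.Φ = constCoeff 𝓒 𝓓.Cinv - 𝓓.Δinv := by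
  have hC : constCoeff 𝓒 𝓓.Cinv * constCoeff 𝓒 𝓓.C = 1 := by
    rw [← constCoeff_mul, 𝓓.Cinv_mul_C, constCoeff_one]
  have h1 : constCoeff 𝓒 𝓓.Cinv - 𝓓.Δinv
      = constCoeff 𝓒 𝓓.Cinv * (pot 𝓓.ψ 𝓓.φ * 𝓓.Δinv) := by
    rw [pot_ψ_φ, Matrix.sub_mul, Δ, 𝓓.Δ_mul_Δinv, Matrix.mul_sub, Matrix.mul_one,
      ← Matrix.mul_assoc, hC, Matrix.one_mul]
  refine (eq_pot (fun i j => ?_) ?_).symm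
  · rw [h1]
    exact rawMat_mul_mem_right (rawMat_mul_mem_left (pot_mem _ _)) i j
  · have h2 : (rawMat 𝓓.Δ * rawMat 𝓓.Δinv).map (dx Ω) = 0 := by
      rw [← rawMat_mul, Δ, 𝓓.Δ_mul_Δinv]
      ext1 i j
      by_cases hij : i = j <;> simp [hij]
    have h3 : rawMat 𝓓.Δinv * rawMat 𝓓.Δ = 1 := by
      rw [← rawMat_mul, Δ, 𝓓.Δinv_mul_Δ, rawMat_one]
    have h4 : (rawMat 𝓓.Δ).map (dx Ω) = 𝓓.ψ.1.transpose * 𝓓.φ.1 := by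
      rw [← rawMat_dxC, dxC_Δ, rawMat_pairing]
    rw [map_derivation_mul, h4] at h2
    have h5 : (rawMat 𝓓.Δinv).map (dx Ω)
        = -(rawMat 𝓓.Δinv * (𝓓.ψ.1.transpose * 𝓓.φ.1 * rawMat 𝓓.Δinv)) := by
      rw [eq_neg_of_add_eq_zero_left h2, Matrix.mul_neg, neg_neg, ← Matrix.mul_assoc, h3,
        Matrix.one_mul]
    rw [rawMat_sub, map_derivation_sub, rawMat_constCoeff, constMat_map_derivation, h5, zero_sub,
      neg_neg, Ψ, Φ, coe_rmul, coe_rmul, Matrix.transpose_mul, rawMat_transpose,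
      Matrix.transpose_transpose]
    simp only [Matrix.mul_assoc]

theorem V_mul_W : 𝓓.V * 𝓓.W = 1 := by
  have h : nonloc 𝓓.φ 𝓓.Ψ * nonloc 𝓓.Φ 𝓓.ψ = nonloc 𝓓.φ 𝓓.Ψ - nonloc 𝓓.Φ 𝓓.ψ := by
    rw [nonloc_mul_nonloc, pot_Ψ_Φ, rmul_sub, Matrix.transpose_sub, rmul_sub, ← Φ, ← Ψ,
      nonloc_sub_left, nonloc_sub_right, nonloc_rmul_const]
    abel
  rw [W, V, mul_sub, mul_one, add_mul, one_mul, h]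
  abel

theorem act_W (f : RightMat 𝓒 N p) : 𝓓.W.act f = f - rmul 𝓓.Φ (pot 𝓓.ψ f) := rfl

theorem actT_V (g : LeftMat 𝓒 N p) :
    𝓓.V.actT g = g - rmul 𝓓.Ψ (pot g 𝓓.φ).transpose := by
  rw [V, actT_add, actT_one, actT_nonloc, sub_eq_add_neg]

theorem act_W_φ : 𝓓.W.act 𝓓.φ = rmul 𝓓.Φ (constCoeff 𝓒 𝓓.C) := by
  rw [act_W, pot_ψ_φ, rmul_sub, rmul_Φ_Δ, sub_sub_cancel]

theorem actT_V_ψ : 𝓓.V.actT 𝓓.ψ = rmul 𝓓.Ψ (constCoeff 𝓒 𝓓.C.transpose) := by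
  rw [actT_V, pot_ψ_φ, Matrix.transpose_sub, rmul_sub, rmul_Ψ_Δ, sub_sub_cancel,
    constCoeff_transpose]

theorem W_mem_constLinear : 𝓓.W ∈ constLinear 𝓒 N :=
  sub_mem (one_mem _) (nonloc_mem_constLinear _ _)

theorem V_mem_constLinear : 𝓓.V ∈ constLinear 𝓒 N :=
  add_mem (one_mem _) (nonloc_mem_constLinear _ _)

theorem W_mul_nonloc (h : RightMat 𝓒 N p) (g : LeftMat 𝓒 N p) :
    𝓓.W * nonloc h g
      = nonloc (𝓓.W.act h) g + nonloc 𝓓.Φ (rmul g (pot 𝓓.ψ h).transpose) := by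
  rw [act_W, nonloc_sub_left, W, sub_mul, one_mul, nonloc_mul_nonloc]
  abel

theorem nonloc_mul_V (h : RightMat 𝓒 N p) (g : LeftMat 𝓒 N p) :
    nonloc h g * 𝓓.V = nonloc h (𝓓.V.actT g) + nonloc (rmul h (pot g 𝓓.φ)) 𝓓.Ψ := by
  rw [actT_V, nonloc_sub_right, V, mul_add, mul_one, nonloc_mul_nonloc]
  abel

/-! ### Conjugation of differential operators, nonlocal terms and `∂/∂t` -/

/-- The nonlocal terms that the transformation adds to the operator `X`. -/
noncomputable def correction : OpAct 𝓒 N →+ OpAct 𝓒 N :=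
  AddMonoidHom.mk' (fun X => nonloc (𝓓.W.act (X.act 𝓓.φ)) 𝓓.Ψ
    - nonloc 𝓓.Φ (𝓓.V.actT (X.actT 𝓓.ψ))) fun X Y => by
      rw [act_add, actT_add, act_map_add, actT_map_add, nonloc_add_left, nonloc_add_right]
      abel

theorem correction_apply (X : OpAct 𝓒 N) :
    𝓓.correction X = nonloc (𝓓.W.act (X.act 𝓓.φ)) 𝓓.Ψ
      - nonloc 𝓓.Φ (𝓓.V.actT (X.actT 𝓓.ψ)) := rfl

/-- Multiplying by `V` on the right and then by `W` on the left, each step splits off one nonlocal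
term and changes only coefficients below the top order. -/
theorem conj_local {k : ℕ} {X : OpAct 𝓒 N} (hX : X ∈ localOps 𝓒 N (k + 1)) :
    𝓓.W * X * 𝓓.V - X - 𝓓.correction X ∈ localOps 𝓒 N k := by
  -- `Y` is the differential part of `XV`.
  obtain ⟨Y, hY⟩ : ∃ Y, Y = X * 𝓓.V - nonloc (X.act 𝓓.φ) 𝓓.Ψ := ⟨_, rfl⟩
  have h1 : Y - X ∈ localOps 𝓒 N k := by
    have := local_mul_nonloc hX 𝓓.φ 𝓓.Ψ
    rwa [hY, V, mul_add, mul_one, add_sub_assoc, add_sub_cancel_left]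
  have hY' : Y ∈ localOps 𝓒 N (k + 1) := by
    have := add_mem (localOps_mono k.le_succ h1) hX
    rwa [sub_add_cancel] at this
  have h2 := nonloc_mul_local hY' 𝓓.Φ 𝓓.ψ
  -- The second term here cancels the extra term that `W_mul_nonloc` produces from `X{φ} D⁻¹ Ψᵀ`.
  have hYψ : Y.actT 𝓓.ψ = 𝓓.V.actT (X.actT 𝓓.ψ)
      + rmul 𝓓.Ψ (pot 𝓓.ψ (X.act 𝓓.φ)).transpose := by
    rw [hY, actT_sub, actT_mul, actT_nonloc, sub_neg_eq_add]
  have h3 : 𝓓.W * X * 𝓓.V - X - 𝓓.correction X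
      = (Y - X) - (nonloc 𝓓.Φ 𝓓.ψ * Y - nonloc 𝓓.Φ (Y.actT 𝓓.ψ)) := by
    have h4 : X * 𝓓.V = Y + nonloc (X.act 𝓓.φ) 𝓓.Ψ := by rw [hY, sub_add_cancel]
    rw [mul_assoc, h4, mul_add, W_mul_nonloc, hYψ, nonloc_add_right, correction_apply]
    nth_rw 1 [W]
    rw [sub_mul, one_mul]
    abel
  rw [h3]
  exact sub_mem h1 h2

/-- Multiplication by `W` leaves two nonlocal terms, and each meets `V` by `nonloc_mul_V`. The two
by-products ending in `Ψᵀ` combine into `W{X{φ}} D⁻¹ Ψᵀ` for `X = h D⁻¹ gᵀ`, as seen by letting the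
first identity act on `φ`. -/
theorem conj_nonloc (h : RightMat 𝓒 N p) (g : LeftMat 𝓒 N p) :
    𝓓.W * nonloc h g * 𝓓.V
      = nonloc (𝓓.W.act h) (𝓓.V.actT g) + 𝓓.correction (nonloc h g) := by
  have h1 : 𝓓.W * nonloc h g
      = nonloc (𝓓.W.act h) g - nonloc 𝓓.Φ ((nonloc h g).actT 𝓓.ψ) := by
    rw [W_mul_nonloc, actT_nonloc, nonloc_neg_right, sub_neg_eq_add]
  have h2 : 𝓓.W.act ((nonloc h g).act 𝓓.φ)
      = rmul (𝓓.W.act h) (pot g 𝓓.φ) - rmul 𝓓.Φ (pot ((nonloc h g).actT 𝓓.ψ) 𝓓.φ) := by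
    rw [← act_mul, h1]; rfl
  rw [h1, sub_mul, nonloc_mul_V, nonloc_mul_V, correction_apply, h2, nonloc_sub_left]
  abel

theorem conj_evol (α : ℂ) : 𝓓.W * evol α * 𝓓.V = evol α + 𝓓.correction (evol α) := by
  have h1 : evol α * 𝓓.V
      = 𝓓.V * evol α + (nonloc (dtR α 𝓓.φ) 𝓓.Ψ + nonloc 𝓓.φ (dtL α 𝓓.Ψ)) := by
    rw [V, mul_add, mul_one, add_mul, one_mul, evol_mul_nonloc]
    abel
  have h2 : 𝓓.W * nonloc 𝓓.φ (dtL α 𝓓.Ψ)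
      = nonloc 𝓓.Φ (rmul (dtL α 𝓓.Ψ) 𝓓.Δ.transpose) := by
    rw [W_mul_nonloc, act_W_φ, nonloc_rmul_const, pot_ψ_φ, Matrix.transpose_sub, rmul_sub,
      nonloc_sub_right]
    abel
  -- The time derivative of `ψ = ΨΔᵀ`, with `Δ_t` expanded by `dtC_Δ`.
  have h3 : dtL α 𝓓.ψ = rmul (dtL α 𝓓.Ψ) 𝓓.Δ.transpose
      + (rmul 𝓓.Ψ (pot (dtL α 𝓓.ψ) 𝓓.φ).transpose
        + rmul 𝓓.Ψ (pot 𝓓.ψ (dtR α 𝓓.φ)).transpose) := by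
    have h4 : dtC α 𝓓.Δ.transpose = (dtC α 𝓓.Δ).transpose := rfl
    conv_lhs => rw [← rmul_Ψ_Δ, dtL_rmul, h4, dtC_Δ, Matrix.transpose_add, rmul_add]
  have h4 : 𝓓.V.actT (dtL α 𝓓.ψ) = rmul (dtL α 𝓓.Ψ) 𝓓.Δ.transpose
      + rmul 𝓓.Ψ (pot 𝓓.ψ (dtR α 𝓓.φ)).transpose := by
    rw [actT_V]
    nth_rw 1 [h3]
    abel
  rw [mul_assoc, h1, mul_add, ← mul_assoc, W_mul_V, one_mul, mul_add, h2, W_mul_nonloc,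
    correction_apply, act_evol, actT_evol, actT_map_neg, nonloc_neg_right, h4, nonloc_add_right]
  abel

/-- The discrepancy in `conj_local` has order below `k`, so it is absorbed in the lower coefficients
and `J` survives. -/
theorem exists_conj_diffOp (k : ℕ) (J : Matrix (Fin N) (Fin N) ℂ) (u : ℕ → CoeffMat 𝓒 N N) :
    ∃ v : ℕ → CoeffMat 𝓒 N N, 𝓓.W * diffOp k J u * 𝓓.V
      = diffOp k J v + 𝓓.correction (diffOp k J u) := by
  obtain ⟨w, hw⟩ := exists_coeffs (𝓓.conj_local (diffOp_mem_localOps k J u))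
  refine ⟨u + w, ?_⟩
  have h : diffOp k J (u + w)
      = diffOp k J u + ∑ i ∈ Finset.range k, mul (w i) * der ^ i := by
    rw [diffOp, diffOp, add_assoc, ← Finset.sum_add_distrib]
    simp only [Pi.add_apply, mul_add_coeff, add_mul]
  rw [h, ← hw]
  abel

/-- By `W{φ} = ΦC` and `V^τ{ψ} = ΨCᵀ` the two terms become `ΦCA D⁻¹Ψᵀ` and `Φ D⁻¹(ΨCᵀB)ᵀ`. The
constant `BᵀC` is then moved through `D⁻¹` to combine them. -/
theorem correction_of_eigen {X : OpAct 𝓒 N} {A B : Matrix (Fin K) (Fin K) ℂ}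
    (hφ : X.act 𝓓.φ = rmul 𝓓.φ (constCoeff 𝓒 A)) (hψ : X.actT 𝓓.ψ = rmul 𝓓.ψ (constCoeff 𝓒 B)) :
    𝓓.correction X
      = nonloc (rmul 𝓓.Φ (constCoeff 𝓒 (𝓓.C * A - B.transpose * 𝓓.C))) 𝓓.Ψ := by
  rw [correction_apply, hφ, hψ, act_rmul_const 𝓓.W_mem_constLinear,
    actT_rmul_const 𝓓.V_mem_constLinear, act_W_φ, actT_V_ψ, rmul_rmul, rmul_rmul,
    ← constCoeff_mul, ← constCoeff_mul, constCoeff_sub, rmul_sub, nonloc_sub_left,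
    nonloc_rmul_const (S := B.transpose * 𝓓.C), ← constCoeff_transpose, Matrix.transpose_mul,
    Matrix.transpose_transpose]

/-! ### Powers of the conjugated operator and chains of nonlocal terms -/

variable {M : OpAct 𝓒 N}

theorem conj_pow_mul_W (j : ℕ) : (𝓓.W * M * 𝓓.V) ^ j * 𝓓.W = 𝓓.W * M ^ j := by
  induction j with
  | zero => simp
  | succ j ih => rw [pow_succ', mul_assoc, ih, mul_assoc, ← mul_assoc 𝓓.V, V_mul_W, one_mul,
      mul_assoc, ← pow_succ']

theorem V_mul_conj_pow (j : ℕ) : 𝓓.V * (𝓓.W * M * 𝓓.V) ^ j = M ^ j * 𝓓.V := by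
  induction j with
  | zero => simp
  | succ j ih => rw [pow_succ, ← mul_assoc, ih, mul_assoc, ← mul_assoc 𝓓.V, ← mul_assoc 𝓓.V,
      V_mul_W, one_mul, ← mul_assoc, ← pow_succ]

theorem act_conj_pow (j : ℕ) (f : RightMat 𝓒 N p) :
    ((𝓓.W * M * 𝓓.V) ^ j).act (𝓓.W.act f) = 𝓓.W.act ((M ^ j).act f) := by
  rw [← act_mul, conj_pow_mul_W, act_mul]

theorem actT_conj_pow (j : ℕ) (g : LeftMat 𝓒 N p) :
    ((𝓓.W * M * 𝓓.V) ^ j).actT (𝓓.V.actT g) = 𝓓.V.actT ((M ^ j).actT g) := by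
  rw [← actT_mul, V_mul_conj_pow, actT_mul]

theorem conj_mem_constLinear (hM : M ∈ constLinear 𝓒 N) :
    𝓓.W * M * 𝓓.V ∈ constLinear 𝓒 N :=
  mul_mem (mul_mem 𝓓.W_mem_constLinear hM) 𝓓.V_mem_constLinear

/-- Since `Φ = W{φ}C⁻¹`, iterating the conjugated operator on `Φ` is iterating `M` on its
eigenfunction `φ`. -/
theorem act_conj_pow_Φ (hM : M ∈ constLinear 𝓒 N) {A : Matrix (Fin K) (Fin K) ℂ}
    (hφ : M.act 𝓓.φ = rmul 𝓓.φ (constCoeff 𝓒 A)) (j : ℕ) :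
    ((𝓓.W * M * 𝓓.V) ^ j).act 𝓓.Φ
      = rmul 𝓓.Φ (constCoeff 𝓒 (𝓓.C * A ^ j * 𝓓.Cinv)) := by
  have h1 : 𝓓.Φ = rmul (𝓓.W.act 𝓓.φ) (constCoeff 𝓒 𝓓.Cinv) := by
    rw [act_W_φ, rmul_rmul, ← constCoeff_mul, 𝓓.C_mul_Cinv, constCoeff_one, rmul_one]
  conv_lhs => rw [h1]
  rw [act_rmul_const (pow_mem (𝓓.conj_mem_constLinear hM) j), act_conj_pow,
    pow_act_of_act hM hφ, act_rmul_const 𝓓.W_mem_constLinear, act_W_φ, rmul_rmul, rmul_rmul,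
    ← constCoeff_mul, ← constCoeff_mul, Matrix.mul_assoc]

theorem actT_conj_pow_Ψ (hM : M ∈ constLinear 𝓒 N) {B : Matrix (Fin K) (Fin K) ℂ}
    (hψ : M.actT 𝓓.ψ = rmul 𝓓.ψ (constCoeff 𝓒 B)) (j : ℕ) :
    ((𝓓.W * M * 𝓓.V) ^ j).actT 𝓓.Ψ
      = rmul 𝓓.Ψ (constCoeff 𝓒 (𝓓.C.transpose * B ^ j * 𝓓.Cinv.transpose)) := by
  have h1 : 𝓓.Ψ = rmul (𝓓.V.actT 𝓓.ψ) (constCoeff 𝓒 𝓓.Cinv.transpose) := by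
    rw [actT_V_ψ, rmul_rmul, ← constCoeff_mul, ← Matrix.transpose_mul, 𝓓.Cinv_mul_C,
      Matrix.transpose_one, constCoeff_one, rmul_one]
  conv_lhs => rw [h1]
  rw [actT_rmul_const (pow_mem (𝓓.conj_mem_constLinear hM) j), actT_conj_pow,
    pow_actT_of_actT hM hψ, actT_rmul_const 𝓓.V_mem_constLinear, actT_V_ψ, rmul_rmul, rmul_rmul,
    ← constCoeff_mul, ← constCoeff_mul, Matrix.mul_assoc]

theorem conj_chainOp (l : ℕ) (q : RightMat 𝓒 N p) (r : LeftMat 𝓒 N p)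
    (S : Matrix (Fin p) (Fin p) ℂ) :
    𝓓.W * chainOp M l q r S * 𝓓.V
      = chainOp (𝓓.W * M * 𝓓.V) l (𝓓.W.act q) (𝓓.V.actT r) S
        + 𝓓.correction (chainOp M l q r S) := by
  rw [chainOp, chainOp, Finset.mul_sum, Finset.sum_mul, map_sum, ← Finset.sum_add_distrib]
  refine Finset.sum_congr rfl fun j _ => ?_
  rw [conj_nonloc, act_rmul_const 𝓓.W_mem_constLinear, act_conj_pow, actT_conj_pow]

/-- Every term of the chain has the form `Φ S D⁻¹ Ψᵀ` with constant `S`, once the factor standing at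
`Ψ` is carried through `D⁻¹`. The sum of the matrices `S` telescopes. -/
theorem chainOp_Φ_Ψ (hM : M ∈ constLinear 𝓒 N) {A B : Matrix (Fin K) (Fin K) ℂ}
    (hφ : M.act 𝓓.φ = rmul 𝓓.φ (constCoeff 𝓒 A)) (hψ : M.actT 𝓓.ψ = rmul 𝓓.ψ (constCoeff 𝓒 B))
    (c : ℂ) (l : ℕ) :
    chainOp (𝓓.W * M * 𝓓.V) l 𝓓.Φ 𝓓.Ψ (c • (𝓓.C * A - B.transpose * 𝓓.C))
      = nonloc (rmul 𝓓.Φ (constCoeff 𝓒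
          (c • (𝓓.C * A ^ (l + 1) - B.transpose ^ (l + 1) * 𝓓.C)))) 𝓓.Ψ := by
  have e : ∀ s, nonloc (rmul (((𝓓.W * M * 𝓓.V) ^ s).act 𝓓.Φ)
        (constCoeff 𝓒 (c • (𝓓.C * A - B.transpose * 𝓓.C))))
        (((𝓓.W * M * 𝓓.V) ^ (l - s)).actT 𝓓.Ψ)
      = nonloc (rmul 𝓓.Φ (constCoeff 𝓒 (c • (𝓓.C * A ^ s * 𝓓.Cinv
          * (𝓓.C * A - B.transpose * 𝓓.C)
          * (𝓓.Cinv * B.transpose ^ (l - s) * 𝓓.C))))) 𝓓.Ψ := by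
    intro s
    rw [𝓓.act_conj_pow_Φ hM hφ, 𝓓.actT_conj_pow_Ψ hM hψ, rmul_rmul, ← constCoeff_mul,
      show 𝓓.C.transpose * B ^ (l - s) * 𝓓.Cinv.transpose
        = (𝓓.Cinv * B.transpose ^ (l - s) * 𝓓.C).transpose by
        rw [Matrix.transpose_mul, Matrix.transpose_mul, Matrix.transpose_pow,
          Matrix.transpose_transpose, Matrix.mul_assoc],
      constCoeff_transpose, ← nonloc_rmul_const, rmul_rmul, ← constCoeff_mul, Matrix.mul_smul,
      Matrix.smul_mul]
  -- Additivity in the constant matrix moves the sum from operators to matrices, where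
  -- `sum_telescope` applies.
  let F : Matrix (Fin K) (Fin K) ℂ →+ OpAct 𝓒 N :=
    AddMonoidHom.mk' (fun S => nonloc (rmul 𝓓.Φ (constCoeff 𝓒 (c • S))) 𝓓.Ψ) fun S T => by
      have h : constCoeff 𝓒 (c • (S + T)) = constCoeff 𝓒 (c • S) + constCoeff 𝓒 (c • T) := by
        rw [smul_add]
        exact Matrix.map_add _ (map_add _) _ _
      rw [h, rmul_add, nonloc_add_left]
  rw [chainOp, Finset.sum_congr rfl fun s _ => e s,
    ← sum_telescope 𝓓.C_mul_Cinv 𝓓.Cinv_mul_C]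
  exact (map_sum F _ _).symm

end DarbouxData

/-! ### Integro-differential expressions as elements of the algebra of operators with actions -/

namespace OpAct

variable {Ω : TopologicalSpace.Opens (ℝ × ℝ)} {𝓒 : FunctionClass Ω} {N p : ℕ}

/-- The element `X` consists of the operator denoted by the expression `P` and of the actions of
`P` and its formal transpose. -/
structure Represents (P : IntDiffExpr Ω N) (X : OpAct 𝓒 N) : Prop where
  op_eq : P.toOp = X.op
  apply_eq : ∀ {p : ℕ} (f : RightMat 𝓒 N p), P.apply 𝓒 f.1 = (X.act f).1
  applyT_eq : ∀ {p : ℕ} (f : LeftMat 𝓒 N p), P.applyT 𝓒 f.1 = (X.actT f).1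

theorem Represents.iterate_apply {P : IntDiffExpr Ω N} {X : OpAct 𝓒 N} (h : Represents P X)
    (j : ℕ) (f : RightMat 𝓒 N p) : (P.apply 𝓒)^[j] f.1 = ((X ^ j).act f).1 := by
  induction j with
  | zero => rfl
  | succ j ih => rw [Function.iterate_succ_apply', ih, h.apply_eq, pow_succ', act_mul]

theorem Represents.iterate_applyT {P : IntDiffExpr Ω N} {X : OpAct 𝓒 N} (h : Represents P X)
    (j : ℕ) (f : LeftMat 𝓒 N p) : (P.applyT 𝓒)^[j] f.1 = ((X ^ j).actT f).1 := by
  induction j with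
  | zero => rfl
  | succ j ih => rw [Function.iterate_succ_apply', ih, h.applyT_eq, pow_succ, actT_mul]

/-- The operator, as an additive map. -/
noncomputable def opHom : OpAct 𝓒 N →+ Matrix (Fin N) (Fin N) (PsiOp Ω) :=
  AddMonoidHom.mk' op op_add

/-- The action on a given matrix, as an additive map. -/
noncomputable def actHom (f : RightMat 𝓒 N p) :
    OpAct 𝓒 N →+ Matrix (Fin N) (Fin p) (SmoothFn Ω) :=
  AddMonoidHom.mk' (fun X => (X.act f).1) fun _ _ => rfl

/-- The action of the transpose on a given matrix, as an additive map. -/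
noncomputable def actTHom (f : LeftMat 𝓒 N p) :
    OpAct 𝓒 N →+ Matrix (Fin N) (Fin p) (SmoothFn Ω) :=
  AddMonoidHom.mk' (fun X => (X.actT f).1) fun _ _ => rfl

theorem op_eq_opHom (X : OpAct 𝓒 N) : X.op = opHom X := rfl

theorem act_eq_actHom (X : OpAct 𝓒 N) (f : RightMat 𝓒 N p) : (X.act f).1 = actHom f X := rfl

theorem actT_eq_actTHom (X : OpAct 𝓒 N) (f : LeftMat 𝓒 N p) : (X.actT f).1 = actTHom f X := rfl

theorem op_pow (X : OpAct 𝓒 N) (j : ℕ) : (X ^ j).op = X.op ^ j := by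
  induction j with
  | zero => rw [pow_zero, pow_zero, op_one]
  | succ j ih => rw [pow_succ, pow_succ, op_mul, ih]

theorem act_der_pow (i : ℕ) (f : RightMat 𝓒 N p) :
    ((der ^ i).act f).1 = f.1.map (dx Ω)^[i] := by
  induction i with
  | zero => rfl
  | succ i ih =>
    rw [pow_succ', act_mul, act_der, coe_dxR, ih, Function.iterate_succ']
    rfl

theorem actT_der_pow (i : ℕ) (f : LeftMat 𝓒 N p) :
    ((der ^ i).actT f).1 = (-1 : ℂ) ^ i • f.1.map (dx Ω)^[i] := by
  induction i with
  | zero => rw [pow_zero, pow_zero, one_smul]; rfl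
  | succ i ih =>
    rw [pow_succ, actT_mul, actT_der, AddSubgroup.coe_neg, coe_dxL, ih, Function.iterate_succ']
    ext1 a b
    simp only [Matrix.neg_apply, Matrix.map_apply, Matrix.smul_apply, Derivation.map_smul,
      Function.comp_apply, pow_succ, mul_neg, mul_one, neg_smul]

theorem op_mul_der_pow (u : CoeffMat 𝓒 N N) (i : ℕ) :
    (mul u * der ^ i).op = mulOp (rawMat u) * Matrix.scalar (Fin N) (opD Ω ^ i) := by
  rw [op_mul, op_coeff, op_pow, op_der, map_pow]

theorem coeffDeriv_smul (a : ℂ) (d : Derivation ℂ (SmoothFn Ω) (SmoothFn Ω)) :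
    coeffDeriv (a • d) = a • coeffDeriv d := by
  apply LinearMap.ext; intro s; ext1; funext i
  rfl

theorem scalar_coeffDeriv_smul (a : ℂ) (d : Derivation ℂ (SmoothFn Ω) (SmoothFn Ω)) :
    Matrix.scalar (Fin N) (coeffDeriv (a • d)) = a • Matrix.scalar (Fin N) (coeffDeriv d) := by
  ext1 i j
  rw [coeffDeriv_smul, Matrix.smul_apply, Matrix.scalar_apply, Matrix.scalar_apply]
  by_cases h : i = j
  · subst h; rw [Matrix.diagonal_apply_eq, Matrix.diagonal_apply_eq]
  · rw [Matrix.diagonal_apply_ne _ h, Matrix.diagonal_apply_ne _ h, smul_zero]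

theorem evol_zero : (evol 0 : OpAct 𝓒 N) = 0 := by
  refine ext_op_act ?_ (fun _ f => ?_) fun _ f => ?_
  · rw [op_evol, scalar_coeffDeriv_smul, zero_smul, op_zero]
  · refine Subtype.ext ?_
    rw [act_evol, act_zero, coe_dtR, zero_smul]; rfl
  · refine Subtype.ext ?_
    rw [actT_evol, actT_zero, AddSubgroup.coe_neg, coe_dtL, zero_smul]
    exact neg_zero

variable (𝓒 N) in
/-- A nonlocal term `h D⁻¹ gᵀ` with `h` over `right` and `g` over `left`. -/
structure ClassTerm where
  p : ℕ
  h : RightMat 𝓒 N p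
  g : LeftMat 𝓒 N p

/-- The underlying nonlocal term. -/
def ClassTerm.term (τ : ClassTerm 𝓒 N) : NonlocalTerm Ω N := ⟨τ.p, τ.h.1, τ.g.1⟩

/-- The operator with actions that a nonlocal term denotes. -/
noncomputable def ClassTerm.toOpAct (τ : ClassTerm 𝓒 N) : OpAct 𝓒 N := nonloc τ.h τ.g

/-- The operator and both actions are additive, so the comparison is made term by term. Agreement of
coefficients is asked only up to order `k`, because the expression ignores the rest of the sequence
`U`. -/
theorem represents (a : ℂ) (k : ℕ) {U : ℕ → Matrix (Fin N) (Fin N) (SmoothFn Ω)}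
    (u : ℕ → CoeffMat 𝓒 N N) (hu : ∀ i ≤ k, U i = rawMat (u i)) (T : List (ClassTerm 𝓒 N)) :
    Represents ⟨a, k, U, T.map ClassTerm.term⟩
      (evol a + ∑ i ∈ Finset.range (k + 1), mul (u i) * der ^ i
        + (T.map ClassTerm.toOpAct).sum) := by
  have hu' : ∀ i ∈ Finset.range (k + 1), U i = rawMat (u i) := fun i hi =>
    hu i (Nat.lt_succ_iff.1 (Finset.mem_range.1 hi))
  refine ⟨?_, fun {p} f => ?_, fun {p} f => ?_⟩
  · rw [op_eq_opHom, map_add, map_add, map_sum, map_list_sum, List.map_map, IntDiffExpr.toOp, List.map_map]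
    refine congrArg₂ _ (congrArg₂ _ ?_ (Finset.sum_congr rfl fun i hi => ?_)) rfl
    · exact (scalar_coeffDeriv_smul a (dt Ω)).symm
    · exact (hu' i hi ▸ op_mul_der_pow (u i) i).symm
  · rw [act_eq_actHom, map_add, map_add, map_sum, map_list_sum, List.map_map, IntDiffExpr.apply, List.map_map]
    refine congrArg₂ _ (congrArg₂ _ rfl (Finset.sum_congr rfl fun i hi => ?_)) rfl
    change U i * (_ : Matrix (Fin N) (Fin p) (SmoothFn Ω)) = ((mul (u i) * der ^ i).act f).1
    rw [hu' i hi, act_mul, act_coeff, coe_lmul, act_der_pow]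
  · have hneg : ∀ (T : List (ClassTerm 𝓒 N))
        (F : ClassTerm 𝓒 N → Matrix (Fin N) (Fin p) (SmoothFn Ω)),
        -(T.map F).sum = (T.map fun τ => -F τ).sum := by
      intro T F
      induction T with
      | nil => simp
      | cons τ T ih => rw [List.map_cons, List.map_cons, List.sum_cons, List.sum_cons, neg_add, ih]
    rw [actT_eq_actTHom, map_add, map_add, map_sum, map_list_sum, List.map_map, IntDiffExpr.applyT, List.map_map,
      sub_eq_add_neg, hneg]
    refine congrArg₂ _ (congrArg₂ _ rfl (Finset.sum_congr rfl fun i hi => ?_)) ?_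
    · change _ • (((U i).transpose * f.1).map _) = ((mul (u i) * der ^ i).actT f).1
      rw [hu' i hi, actT_mul, actT_coeff, actT_der_pow, coe_lmul, rawMat_transpose]
    · refine congrArg List.sum (List.map_congr_left fun τ _ => ?_)
      -- `pot` takes its left factor first, so `D⁻¹{hᵀf}` appears as the transpose of `D⁻¹{fᵀh}`.
      change -(τ.g.1 * (τ.h.1.transpose * f.1).map 𝓒.dInv)
        = -(τ.g.1 * ((f.1.transpose * τ.h.1).map 𝓒.dInv).transpose)
      rw [← Matrix.transpose_map, Matrix.transpose_mul, Matrix.transpose_transpose]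

/-- The coefficients of a differential operator with constant leading coefficient. -/
noncomputable def leadCoeffs (k : ℕ) (J : Matrix (Fin N) (Fin N) ℂ) (u : ℕ → CoeffMat 𝓒 N N)
    (i : ℕ) : CoeffMat 𝓒 N N :=
  if i = k then constCoeff 𝓒 J else u i

theorem withLead_eq_rawMat {k : ℕ} (J : Matrix (Fin N) (Fin N) ℂ)
    {U : ℕ → Matrix (Fin N) (Fin N) (SmoothFn Ω)} {u : ℕ → CoeffMat 𝓒 N N}
    (hu : ∀ i < k, U i = rawMat (u i)) (i : ℕ) (hi : i ≤ k) :
    withLead k J U i = rawMat (leadCoeffs k J u i) := by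
  by_cases h : i = k
  · rw [withLead, leadCoeffs, if_pos h, if_pos h, rawMat_constCoeff]
  · rw [withLead, leadCoeffs, if_neg h, if_neg h, hu i (lt_of_le_of_ne hi h)]

theorem sum_leadCoeffs (k : ℕ) (J : Matrix (Fin N) (Fin N) ℂ) (u : ℕ → CoeffMat 𝓒 N N) :
    ∑ i ∈ Finset.range (k + 1), mul (leadCoeffs k J u i) * der ^ i = diffOp k J u := by
  rw [Finset.sum_range_succ, diffOp, add_comm, leadCoeffs, if_pos rfl]
  refine congrArg _ (Finset.sum_congr rfl fun i hi => ?_)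
  rw [leadCoeffs, if_neg (Finset.mem_range.1 hi).ne]

theorem represents_lead {k : ℕ} (J : Matrix (Fin N) (Fin N) ℂ)
    {U : ℕ → Matrix (Fin N) (Fin N) (SmoothFn Ω)} {u : ℕ → CoeffMat 𝓒 N N}
    (hu : ∀ i < k, U i = rawMat (u i)) (T : List (ClassTerm 𝓒 N)) :
    Represents ⟨0, k, withLead k J U, T.map ClassTerm.term⟩
      (diffOp k J u + (T.map ClassTerm.toOpAct).sum) := by
  have h := represents (0 : ℂ) k (leadCoeffs k J u) (withLead_eq_rawMat J hu) T
  rwa [evol_zero, zero_add, sum_leadCoeffs] at h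

theorem represents_evolExpr (α : ℂ) {n : ℕ} (J : Matrix (Fin N) (Fin N) ℂ)
    {U : ℕ → Matrix (Fin N) (Fin N) (SmoothFn Ω)} {u : ℕ → CoeffMat 𝓒 N N}
    (hu : ∀ i < n, U i = rawMat (u i)) (T : List (ClassTerm 𝓒 N)) :
    Represents (evolExpr α n J U (T.map ClassTerm.term))
      (evol α - diffOp n J u + (T.map ClassTerm.toOpAct).sum) := by
  have h := represents α n (fun i => -leadCoeffs n J u i)
    (U := fun i => -withLead n J U i)
    (fun i hi => by rw [withLead_eq_rawMat J hu i hi, rawMat_neg]) T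
  have e : ∑ i ∈ Finset.range (n + 1), mul (-leadCoeffs n J u i) * der ^ i = -diffOp n J u := by
    rw [← sum_leadCoeffs, ← Finset.sum_neg_distrib]
    exact Finset.sum_congr rfl fun i _ => by rw [mul_neg_coeff, neg_mul]
  rwa [e, ← sub_eq_add_neg] at h

/-- The terms `q[j] S D⁻¹ rᵀ[l-j]`. -/
noncomputable def chainClassTerms (M : OpAct 𝓒 N) (l : ℕ) (q : RightMat 𝓒 N p)
    (r : LeftMat 𝓒 N p) (S : Matrix (Fin p) (Fin p) ℂ) : List (ClassTerm 𝓒 N) :=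
  (List.range (l + 1)).map fun j =>
    ⟨p, rmul ((M ^ j).act q) (constCoeff 𝓒 S), (M ^ (l - j)).actT r⟩

theorem smul_mul_constMat {l m n : ℕ} (c : ℂ) (A : Matrix (Fin l) (Fin m) (SmoothFn Ω))
    (S : Matrix (Fin m) (Fin n) ℂ) : c • (A * constMat Ω S) = A * constMat Ω (c • S) := by
  have h : constMat Ω (c • S) = c • constMat Ω S := by
    ext1 i j
    simp only [constMat, Matrix.map_apply, Matrix.smul_apply, smul_eq_mul, map_mul,
      Algebra.smul_def]
  rw [h, Matrix.mul_smul]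

theorem eq_mul_constMat_of_add_smul_eq_zero {l m n : ℕ} {c : ℂ}
    {A : Matrix (Fin l) (Fin n) (SmoothFn Ω)} {B : Matrix (Fin l) (Fin m) (SmoothFn Ω)}
    {S : Matrix (Fin m) (Fin n) ℂ} (h : A + c • (B * constMat Ω S) = 0) :
    A = B * constMat Ω ((-c) • S) := by
  rw [← smul_mul_constMat, neg_smul]
  exact eq_neg_of_add_eq_zero_left h

/-- Iterated actions become powers in `OpAct`, and the scalar `c` is absorbed into the constant
matrix, so chains need no separate prefactor. -/
theorem chainTerms_eq {P : IntDiffExpr Ω N} {M : OpAct 𝓒 N} (h : Represents P M) (c : ℂ) (l : ℕ)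
    (q : RightMat 𝓒 N p) (r : LeftMat 𝓒 N p) (S : Matrix (Fin p) (Fin p) ℂ) :
    chainTerms 𝓒 P c l q.1 r.1 S = (chainClassTerms M l q r (c • S)).map ClassTerm.term := by
  rw [chainTerms, chainClassTerms, List.map_map]
  refine List.map_congr_left fun j _ => ?_
  rw [h.iterate_apply, h.iterate_applyT, smul_mul_constMat]
  rfl

theorem sum_chainClassTerms (M : OpAct 𝓒 N) (l : ℕ) (q : RightMat 𝓒 N p) (r : LeftMat 𝓒 N p)
    (S : Matrix (Fin p) (Fin p) ℂ) :
    ((chainClassTerms M l q r S).map ClassTerm.toOpAct).sum = chainOp M l q r S := by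
  rw [chainClassTerms, List.map_map]
  rfl

end OpAct

namespace DarbouxData

open OpAct

variable {Ω : TopologicalSpace.Opens (ℝ × ℝ)} {𝓒 : FunctionClass Ω} {N K : ℕ}
  (𝓓 : DarbouxData 𝓒 N K)

theorem rawMat_Δinv : rawMat 𝓓.Δinv = (bdtDelta 𝓒 𝓓.φ.1 𝓓.ψ.1 𝓓.C)⁻¹ := by
  refine (Matrix.inv_eq_left_inv ?_).symm
  have h := congrArg rawMat 𝓓.Δinv_mul_Δ
  rwa [rawMat_mul, rawMat_one] at h

theorem represents_W : Represents (bdt 𝓒 𝓓.φ.1 𝓓.ψ.1 𝓓.C) 𝓓.W := by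
  have h := represents (0 : ℂ) 0 (fun _ => (1 : CoeffMat 𝓒 N N)) (U := fun _ => 1)
    (fun _ _ => rawMat_one.symm) [⟨K, -𝓓.Φ, 𝓓.ψ⟩]
  rw [bdt, ← rawMat_Δinv]
  have e : 𝓓.W = evol 0 + ∑ i ∈ Finset.range (0 + 1), mul (1 : CoeffMat 𝓒 N N) * der ^ i
      + (List.map ClassTerm.toOpAct [⟨K, -𝓓.Φ, 𝓓.ψ⟩]).sum := by
    rw [evol_zero, zero_add, Finset.sum_range_one, pow_zero, mul_one, mul_one_coeff,
      List.map_singleton, List.sum_singleton, ClassTerm.toOpAct, nonloc_neg_left, W,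
      sub_eq_add_neg]
  rw [e]
  exact h

theorem represents_V : Represents (bdtInv 𝓒 𝓓.φ.1 𝓓.ψ.1 𝓓.C) 𝓓.V := by
  have h := represents (0 : ℂ) 0 (fun _ => (1 : CoeffMat 𝓒 N N)) (U := fun _ => 1)
    (fun _ _ => rawMat_one.symm) [⟨K, 𝓓.φ, 𝓓.Ψ⟩]
  rw [bdtInv, ← rawMat_Δinv]
  have e : 𝓓.V = evol 0 + ∑ i ∈ Finset.range (0 + 1), mul (1 : CoeffMat 𝓒 N N) * der ^ i
      + (List.map ClassTerm.toOpAct [⟨K, 𝓓.φ, 𝓓.Ψ⟩]).sum := by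
    rw [evol_zero, zero_add, Finset.sum_range_one, pow_zero, mul_one, mul_one_coeff,
      List.map_singleton, List.sum_singleton, ClassTerm.toOpAct, V]
  rw [e]
  exact h

theorem hasDiffPart_conj {k : ℕ} (J : Matrix (Fin N) (Fin N) ℂ)
    {U : ℕ → Matrix (Fin N) (Fin N) (SmoothFn Ω)} {u v : ℕ → CoeffMat 𝓒 N N}
    (hu : ∀ i < k, U i = rawMat (u i))
    (hv : 𝓓.W * diffOp k J u * 𝓓.V = diffOp k J v + 𝓓.correction (diffOp k J u)) :
    HasDiffPart ((bdt 𝓒 𝓓.φ.1 𝓓.ψ.1 𝓓.C).toOp * (diffExpr k J U).toOp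
      * (bdtInv 𝓒 𝓓.φ.1 𝓓.ψ.1 𝓓.C).toOp) k (withLead k J fun i => rawMat (v i)) := by
  have hB : (diffExpr k J U).toOp = (diffOp k J u).op := by
    have h := (represents_lead J hu []).op_eq
    rwa [List.map_nil, List.map_nil, List.sum_nil, add_zero] at h
  rw [𝓓.represents_W.op_eq, 𝓓.represents_V.op_eq, hB, ← op_mul, ← op_mul, hv]
  have h := (represents_lead (k := k) J (U := fun i => rawMat (v i)) (fun _ _ => rfl)
    -- The nonlocal tail is exactly the correction, with the minus sign of its second term placed on
    -- `Φ`.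
    [⟨K, 𝓓.W.act ((diffOp k J u).act 𝓓.φ), 𝓓.Ψ⟩,
      ⟨K, -𝓓.Φ, 𝓓.V.actT ((diffOp k J u).actT 𝓓.ψ)⟩]).op_eq
  refine ⟨_, Eq.trans ?_ h.symm⟩
  rw [List.map_cons, List.map_singleton, List.sum_cons, List.sum_singleton, ClassTerm.toOpAct,
    ClassTerm.toOpAct, nonloc_neg_left, ← sub_eq_add_neg, correction_apply]

end DarbouxData

/-! ### Lifting the data to the function classes and assembling the theorem -/

theorem exists_coeffMat_seq {Ω : TopologicalSpace.Opens (ℝ × ℝ)} {𝓒 : FunctionClass Ω} {N k : ℕ}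
    {u : ℕ → Matrix (Fin N) (Fin N) (SmoothFn Ω)} (hu : ∀ i < k, ∀ a b, u i a b ∈ 𝓒.coeff) :
    ∃ u' : ℕ → CoeffMat 𝓒 N N, ∀ i < k, u i = rawMat (u' i) := by
  have h : ∀ i, ∃ A : CoeffMat 𝓒 N N, i < k → u i = rawMat A := by
    intro i
    by_cases hi : i < k
    · obtain ⟨A, hA⟩ := exists_rawMat (hu i hi)
      exact ⟨A, fun _ => hA.symm⟩
    · exact ⟨0, fun h => absurd h hi⟩
  choose u' hu' using h
  exact ⟨u', hu'⟩

theorem exists_entries {Ω : TopologicalSpace.Opens (ℝ × ℝ)} {𝓒 : FunctionClass Ω} {N p : ℕ}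
    {S : Submodule 𝓒.coeff (SmoothFn Ω)} {f : Matrix (Fin N) (Fin p) (SmoothFn Ω)}
    (hf : ∀ a b, f a b ∈ S) : ∃ g : entries S N p, g.1 = f :=
  ⟨⟨f, hf⟩, rfl⟩

end Development

open OpAct DarbouxData
set_option maxHeartbeats 800000 in
theorem theorem3 (Ω : TopologicalSpace.Opens (ℝ × ℝ)) (𝓒 : FunctionClass Ω)
    (N m K k l n : ℕ) (α c : ℂ)
    -- the operators `M` and `L`
    (J Jt : Matrix (Fin N) (Fin N) ℂ)
    (u v : ℕ → Matrix (Fin N) (Fin N) (SmoothFn Ω))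
    (hu : ∀ i < k, ∀ a b, u i a b ∈ 𝓒.coeff)
    (hv : ∀ i < n, ∀ a b, v i a b ∈ 𝓒.coeff)
    (q r : Matrix (Fin N) (Fin m) (SmoothFn Ω))
    (hq : ∀ a b, q a b ∈ 𝓒.right) (hr : ∀ a b, r a b ∈ 𝓒.left)
    (M0 : Matrix (Fin m) (Fin m) ℂ)
    (M L : IntDiffExpr Ω N)
    (hM : M = evolExpr α n Jt v [⟨m, -(q * constMat Ω M0), r⟩])
    (hL : L = ⟨0, k, withLead k J u, chainTerms 𝓒 M c l q r M0⟩)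
    -- the data of the binary Darboux transformation
    (φ ψ : Matrix (Fin N) (Fin K) (SmoothFn Ω))
    (hφ : ∀ a b, φ a b ∈ 𝓒.right) (hψ : ∀ a b, ψ a b ∈ 𝓒.left)
    (Λ Λt C : Matrix (Fin K) (Fin K) ℂ) (hC : IsUnit C)
    (hΔ : IsUnit (bdtDelta 𝓒 φ ψ C))
    (hΔc : ∀ a b, (bdtDelta 𝓒 φ ψ C)⁻¹ a b ∈ 𝓒.coeff)
    -- the linear problems
    (hMφ : M.apply 𝓒 φ = φ * constMat Ω Λ)
    (hMψ : M.applyT 𝓒 ψ = ψ * constMat Ω Λt)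
    (hLφ : L.apply 𝓒 φ + c • (M.apply 𝓒)^[l + 1] φ = 0)
    (hLψ : L.applyT 𝓒 ψ + c • (M.applyT 𝓒)^[l + 1] ψ = 0)
    -- the transformation and the transformed functions
    (W Winv : IntDiffExpr Ω N) (hW : W = bdt 𝓒 φ ψ C) (hWinv : Winv = bdtInv 𝓒 φ ψ C)
    (qh rh : Matrix (Fin N) (Fin m) (SmoothFn Ω))
    (hqh : qh = W.apply 𝓒 q) (hrh : rh = Winv.applyT 𝓒 r)
    (Φ Ψ : Matrix (Fin N) (Fin K) (SmoothFn Ω))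
    (hΦ : Φ = φ * (bdtDelta 𝓒 φ ψ C)⁻¹)
    (hΨ : Ψ = ψ * ((bdtDelta 𝓒 φ ψ C)⁻¹).transpose)
    (M1 : Matrix (Fin K) (Fin K) ℂ) (hM1 : M1 = C * Λ - Λt.transpose * C) :
    -- `Winv` is the inverse of `W`
    W.toOp * Winv.toOp = 1 ∧ Winv.toOp * W.toOp = 1 ∧
    ∃ (uh vh : ℕ → Matrix (Fin N) (Fin N) (SmoothFn Ω)) (Mh Lh : IntDiffExpr Ω N),
      (∀ i < k, ∀ a b, uh i a b ∈ 𝓒.coeff) ∧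
      (∀ i < n, ∀ a b, vh i a b ∈ 𝓒.coeff) ∧
      -- the new coefficients depend only on the old ones and on the transformation
      HasDiffPart (W.toOp * (diffExpr k J u).toOp * Winv.toOp) k (withLead k J uh) ∧
      HasDiffPart (W.toOp * (diffExpr n Jt v).toOp * Winv.toOp) n (withLead n Jt vh) ∧
      -- the form of the transformed operators
      Mh = evolExpr α n Jt vh [⟨m, -(qh * constMat Ω M0), rh⟩, ⟨K, Φ * constMat Ω M1, Ψ⟩] ∧
      Lh = ⟨0, k, withLead k J uh,
        chainTerms 𝓒 Mh c l qh rh M0 ++ chainTerms 𝓒 Mh (-c) l Φ Ψ M1⟩ ∧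
      W.toOp * M.toOp * Winv.toOp = Mh.toOp ∧
      W.toOp * L.toOp * Winv.toOp = Lh.toOp ∧
      W.toOp * (L.toOp + c • M.toOp ^ (l + 1)) * Winv.toOp
        = Lh.toOp + c • Mh.toOp ^ (l + 1) := by
  subst hM hL hW hWinv hqh hrh hΦ hΨ hM1
  obtain ⟨u', hu'⟩ := exists_coeffMat_seq hu
  obtain ⟨v', hv'⟩ := exists_coeffMat_seq hv
  obtain ⟨q, rfl⟩ := exists_entries hq
  obtain ⟨r, rfl⟩ := exists_entries hr
  obtain ⟨φ, rfl⟩ := exists_entries hφ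
  obtain ⟨ψ, rfl⟩ := exists_entries hψ
  obtain ⟨Δinv, hΔinv⟩ := exists_rawMat hΔc
  have hΔdet := (Matrix.isUnit_iff_isUnit_det _).1 hΔ
  have hCdet := (Matrix.isUnit_iff_isUnit_det _).1 hC
  have hΔraw : rawMat (constCoeff 𝓒 C + pot ψ φ) = bdtDelta 𝓒 φ.1 ψ.1 C := rfl
  obtain ⟨𝓓, rfl, rfl, rfl⟩ : ∃ 𝓓 : DarbouxData 𝓒 N K, 𝓓.φ = φ ∧ 𝓓.ψ = ψ ∧ 𝓓.C = C :=
    ⟨⟨φ, ψ, C, C⁻¹, Δinv, Matrix.mul_nonsing_inv C hCdet, Matrix.nonsing_inv_mul C hCdet,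
      rawMat_injective (by
        rw [rawMat_mul, hΔraw, hΔinv, rawMat_one, Matrix.mul_nonsing_inv _ hΔdet]),
      rawMat_injective (by
        rw [rawMat_mul, hΔraw, hΔinv, rawMat_one, Matrix.nonsing_inv_mul _ hΔdet])⟩, rfl, rfl, rfl⟩
  have hW := 𝓓.represents_W
  have hV := 𝓓.represents_V
  -- the operators `M` and `L` with their actions
  obtain ⟨XM, hXM⟩ : ∃ X, X = evol α - diffOp n Jt v' + nonloc (-rmul q (constCoeff 𝓒 M0)) r :=
    ⟨_, rfl⟩
  have hM : Represents (evolExpr α n Jt v [⟨m, -(q.1 * constMat Ω M0), r.1⟩]) XM := by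
    have h := represents_evolExpr α Jt hv' [⟨m, -rmul q (constCoeff 𝓒 M0), r⟩]
    rw [List.map_singleton, List.map_singleton, List.sum_singleton] at h
    rw [hXM]
    exact h
  have hXMc : XM ∈ constLinear 𝓒 N := by
    rw [hXM]
    exact add_mem (sub_mem (evol_mem_constLinear α) (diffOp_mem_constLinear _ _ _))
      (nonloc_mem_constLinear _ _)
  -- From here on the expression `M` enters only through the fact that it denotes `XM`; likewise for
  -- `L` below.
  generalize evolExpr α n Jt v [⟨m, -(q.1 * constMat Ω M0), r.1⟩] = M at *
  obtain ⟨XL, hXL⟩ : ∃ X, X = diffOp k J u' + chainOp XM l q r (c • M0) := ⟨_, rfl⟩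
  have hL : Represents ⟨0, k, withLead k J u, chainTerms 𝓒 M c l q.1 r.1 M0⟩ XL := by
    have h := represents_lead J hu' (chainClassTerms XM l q r (c • M0))
    rwa [← chainTerms_eq hM, sum_chainClassTerms, ← hXL] at h
  generalize (⟨0, k, withLead k J u, chainTerms 𝓒 M c l q.1 r.1 M0⟩ : IntDiffExpr Ω N) = L at *
  -- the linear problems
  have hMφ' : XM.act 𝓓.φ = rmul 𝓓.φ (constCoeff 𝓒 Λ) :=
    Subtype.ext ((hM.apply_eq _).symm.trans hMφ)
  have hMψ' : XM.actT 𝓓.ψ = rmul 𝓓.ψ (constCoeff 𝓒 Λt) :=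
    Subtype.ext ((hM.applyT_eq _).symm.trans hMψ)
  -- As `M^(l+1){φ} = φΛ^(l+1)`, the equation for `L + cM^(l+1)` makes `φ` an eigenfunction of `L`
  -- alone.
  have hLφ' : XL.act 𝓓.φ = rmul 𝓓.φ (constCoeff 𝓒 ((-c) • Λ ^ (l + 1))) := by
    refine Subtype.ext ?_
    rw [hL.apply_eq, hM.iterate_apply, pow_act_of_act hXMc hMφ'] at hLφ
    exact eq_mul_constMat_of_add_smul_eq_zero hLφ
  have hLψ' : XL.actT 𝓓.ψ = rmul 𝓓.ψ (constCoeff 𝓒 ((-c) • Λt ^ (l + 1))) := by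
    refine Subtype.ext ?_
    rw [hL.applyT_eq, hM.iterate_applyT, pow_actT_of_actT hXMc hMψ'] at hLψ
    exact eq_mul_constMat_of_add_smul_eq_zero hLψ
  -- the transformed operators
  obtain ⟨uh, huh⟩ := 𝓓.exists_conj_diffOp k J u'
  obtain ⟨vh, hvh⟩ := 𝓓.exists_conj_diffOp n Jt v'
  -- The corrections of the three kinds of terms add up to the correction of `XM`, which the
  -- eigenvalue equations evaluate.
  have hconjM : 𝓓.W * XM * 𝓓.V = evol α - diffOp n Jt vh
      + (nonloc (-rmul (𝓓.W.act q) (constCoeff 𝓒 M0)) (𝓓.V.actT r)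
        + nonloc (rmul 𝓓.Φ (constCoeff 𝓒 (𝓓.C * Λ - Λt.transpose * 𝓓.C))) 𝓓.Ψ) := by
    rw [← 𝓓.correction_of_eigen hMφ' hMψ', hXM, map_add, map_sub, mul_add, add_mul, mul_sub,
      sub_mul, 𝓓.conj_evol, hvh, 𝓓.conj_nonloc, act_map_neg, act_rmul_const 𝓓.W_mem_constLinear]
    abel
  -- The total correction is `Φ` times `-c` times a difference of powers; read backwards,
  -- `chainOp_Φ_Ψ` expands it into the chain of `Φ[s]` and `Ψ[l-s]`.
  have hconjL : 𝓓.W * XL * 𝓓.V = diffOp k J uh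
      + (chainOp (𝓓.W * XM * 𝓓.V) l (𝓓.W.act q) (𝓓.V.actT r) (c • M0)
        + chainOp (𝓓.W * XM * 𝓓.V) l 𝓓.Φ 𝓓.Ψ ((-c) • (𝓓.C * Λ - Λt.transpose * 𝓓.C))) := by
    have h := 𝓓.correction_of_eigen hLφ' hLψ'
    rw [Matrix.mul_smul, Matrix.transpose_smul, Matrix.smul_mul, ← smul_sub,
      Matrix.transpose_pow] at h
    rw [𝓓.chainOp_Φ_Ψ hXMc hMφ' hMψ', ← h, hXL, map_add, mul_add, add_mul, huh, 𝓓.conj_chainOp]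
    abel
  have hq' : (bdt 𝓒 𝓓.φ.1 𝓓.ψ.1 𝓓.C).apply 𝓒 q.1 = (𝓓.W.act q).1 := hW.apply_eq q
  have hr' : (bdtInv 𝓒 𝓓.φ.1 𝓓.ψ.1 𝓓.C).applyT 𝓒 r.1 = (𝓓.V.actT r).1 := hV.applyT_eq r
  have hΦ' : 𝓓.φ.1 * (bdtDelta 𝓒 𝓓.φ.1 𝓓.ψ.1 𝓓.C)⁻¹ = 𝓓.Φ.1 := by
    rw [← 𝓓.rawMat_Δinv]; rfl
  have hΨ' : 𝓓.ψ.1 * ((bdtDelta 𝓒 𝓓.φ.1 𝓓.ψ.1 𝓓.C)⁻¹).transpose = 𝓓.Ψ.1 := by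
    rw [← 𝓓.rawMat_Δinv]; rfl
  rw [hq', hr', hΦ', hΨ']
  have hMh : Represents (evolExpr α n Jt (fun i => rawMat (vh i))
      [⟨m, -((𝓓.W.act q).1 * constMat Ω M0), (𝓓.V.actT r).1⟩,
        ⟨K, 𝓓.Φ.1 * constMat Ω (𝓓.C * Λ - Λt.transpose * 𝓓.C), 𝓓.Ψ.1⟩])
      (𝓓.W * XM * 𝓓.V) := by
    have h := represents_evolExpr α Jt (U := fun i => rawMat (vh i)) (n := n) (fun _ _ => rfl)
      [⟨m, -rmul (𝓓.W.act q) (constCoeff 𝓒 M0), 𝓓.V.actT r⟩,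
        ⟨K, rmul 𝓓.Φ (constCoeff 𝓒 (𝓓.C * Λ - Λt.transpose * 𝓓.C)), 𝓓.Ψ⟩]
    simp only [List.map_cons, List.map_nil, List.sum_cons, List.sum_nil, add_zero] at h
    rw [hconjM]
    exact h
  have hLh := represents_lead J (U := fun i => rawMat (uh i)) (k := k) (fun _ _ => rfl)
    (chainClassTerms (𝓓.W * XM * 𝓓.V) l (𝓓.W.act q) (𝓓.V.actT r) (c • M0)
      ++ chainClassTerms (𝓓.W * XM * 𝓓.V) l 𝓓.Φ 𝓓.Ψ ((-c) • (𝓓.C * Λ - Λt.transpose * 𝓓.C)))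
  rw [List.map_append, List.map_append, List.sum_append, ← chainTerms_eq hMh,
    ← chainTerms_eq hMh, sum_chainClassTerms, sum_chainClassTerms, ← hconjL] at hLh
  have hopM := hMh.op_eq
  have hopL := hLh.op_eq
  -- Obtained from `conj_pow_mul_W` by multiplying on the right with `V` and cancelling `WV`.
  have hpow : 𝓓.W.op * XM.op ^ (l + 1) * 𝓓.V.op = (𝓓.W.op * XM.op * 𝓓.V.op) ^ (l + 1) := by
    have h := congrArg OpAct.op (congrArg (· * 𝓓.V) (𝓓.conj_pow_mul_W (M := XM) (l + 1)))
    simp only [mul_assoc _ 𝓓.W 𝓓.V, 𝓓.W_mul_V, mul_one] at h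
    simpa only [op_pow, op_mul] using h.symm
  rw [op_mul, op_mul] at hopM hopL
  rw [hW.op_eq, hV.op_eq, hM.op_eq, hL.op_eq]
  refine ⟨congrArg OpAct.op 𝓓.W_mul_V, congrArg OpAct.op 𝓓.V_mul_W, _, _, _, _,
    fun i _ a b => rawMat_mem (uh i) a b, fun i _ a b => rawMat_mem (vh i) a b, ?_, ?_, rfl, rfl,
    hopM.symm, hopL.symm, ?_⟩
  · rw [← hW.op_eq, ← hV.op_eq]; exact 𝓓.hasDiffPart_conj J hu' huh
  · rw [← hW.op_eq, ← hV.op_eq]; exact 𝓓.hasDiffPart_conj Jt hv' hvh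
  · rw [hopM, hopL, mul_add, add_mul, Matrix.mul_smul, Matrix.smul_mul, hpow]
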